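/- **Setting.** Let $K$ items be given. Vectors $\nu\in\mathbb R^{\binom K2}$ are indexed by the pairs $(i,j)$ with $1\le i<j\le K$. Let $B$ be the $\binom K2\times K$ matrix with $(B\mu)_{ij}=\mu_i-\mu_j$. Let $C$ be the $\binom K2\times\binom K3$ matrix whose column $c_{(i,j,k)}$, $i<j<k$, has entry $1$ at $(i,j)$ and $(j,k)$, entry $-1$ at $(i,k)$, and entry $0$ elsewhere. Suppose $\nu=B\mu+\nu_{\rm cyclic}$ with $\sum_i\mu_i=0$ and $\nu_{\rm cyclic}=C\gamma$, where $\gamma$ is a minimal model of $\nu_{\rm cyclic}$: no $\gamma'$ with $C\gamma'=\nu_{\rm cyclic}$ has fewer non-zero coefficients. Suppose that the set $s$ of the triads with $\gamma_{ijk}\ne0$ is known (in particular, the model may be intermediate, i.e. $\mathcal L\subsetneq \mathrm{span}(B,C_s)\subsetneq\mathbb R^{\binom K2}$ with $\mathcal L$ the column space of $B$), let $C_s$ be the sub-matrix of $C$ with the columns in $s$, and let $\gamma_s=(\gamma_t)_{t\in s}$. For each pair $i<j$ there are $n_{ij}$ observations $Y_{ijk}=\nu_{ij}+\epsilon_{ijk}$,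 $k=1,\dots,n_{ij}$, where the errors $\epsilon_{ijk}$ are IID with mean zero and finite variance $\sigma^2$. Let $n=\sum_{i<j}n_{ij}$, let $Y$ be the vector of all observations, let $L$ be the $n\times\binom K2$ zero-one matrix with $\mathbb E(Y)=L\nu$, let $N$ be the $K\times K$ Laplacian of the comparison graph with edge weights $n_{ij}$, and let $A^+$ denote the Moore–Penrose inverse of $A$. Put $$\widehat\gamma_s=\bigl(C_s^\top L^\top(I-LBN^+B^\top L^\top)LC_s\bigr)^+C_s^\top L^\top(I-LBN^+B^\top L^\top)Y,\qquad \widehat\mu=N^+B^\top L^\top(Y-LC_s\widehat\gamma_s).$$ **Theorem.** 1. If $n_{ij}>0$ for all $i<j$, then $(\widehat\mu,\widehat\gamma_s)$ is the unique least-squares estimator, i.e. the unique minimizer of $\|Y-L(B\mu+C_s\gamma_s)\|^2$ over all $\mu,\gamma_s$ with $\sum_i\mu_i=0$, and it is unbiased: $\mathbb E\,\widehat\mu=\mu$ and $\mathbb E\,\widehat\gamma_s=\gamma_s$. 2. If $n_{ij}\to\infty$ for all $i<j$, then $(\widehat\mu,\widehat\gamma_s)\to(\mu,\gamma_s)$ in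 probability. 3. If $n_{ij}\to\infty$ and $n_{ij}/n\to\theta_{ij}>0$ for all $i<j$, then, with $\Xi=\mathrm{diag}(\theta_{ij})$, $$\sqrt n\begin{pmatrix}\widehat\mu-\mu\\ \widehat\gamma_s-\gamma_s\end{pmatrix}\Rightarrow\mathcal N(0,\Sigma),\qquad \Sigma=\sigma^2\,G^+\begin{pmatrix}B^\top\\ C_s^\top\end{pmatrix}\Xi\,(B,\,C_s)\,G^+,\qquad G=\begin{pmatrix}B^\top\Xi B& B^\top\Xi C_s\\ C_s^\top\Xi B& C_s^\top\Xi C_s\end{pmatrix}.$$ -/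

import Mathlib

open Matrix MeasureTheory ProbabilityTheory Filter
open scoped Topology

namespace PairedComparison

/-! ### The Moore-Penrose inverse of a real matrix -/

section MoorePenrose

/-- The four Penrose equations: `G` is the Moore-Penrose inverse of the real matrix `A`. -/
structure IsMoorePenrose {α β : Type*} [Fintype α] [Fintype β]
    (A : Matrix α β ℝ) (G : Matrix β α ℝ) : Prop where
  mul_mul_self : A * G * A = A
  mul_mul_inv : G * A * G = G
  symm_left : (A * G)ᵀ = A * G
  symm_right : (G * A)ᵀ = G * A

theorem IsMoorePenrose.unique {α β : Type*} [Fintype α] [Fintype β]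
    {A : Matrix α β ℝ} {G H : Matrix β α ℝ}
    (hG : IsMoorePenrose A G) (hH : IsMoorePenrose A H) : G = H := by
  have h1 : A * G = A * H := by
    calc A * G = (A * H * A) * G := by rw [hH.mul_mul_self]
      _ = (A * H)ᵀ * (A * G)ᵀ := by rw [hH.symm_left, hG.symm_left]; simp only [Matrix.mul_assoc]
      _ = ((A * G * A) * H)ᵀ := by rw [← Matrix.transpose_mul]; simp only [Matrix.mul_assoc]
      _ = A * H := by rw [hG.mul_mul_self, hH.symm_left]
  have h2 : G * A = H * A := by
    calc G * A = G * (A * H * A) := by rw [hH.mul_mul_self]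
      _ = (G * A)ᵀ * (H * A)ᵀ := by rw [hH.symm_right, hG.symm_right]; simp only [Matrix.mul_assoc]
      _ = (H * (A * G * A))ᵀ := by rw [← Matrix.transpose_mul]; simp only [Matrix.mul_assoc]
      _ = H * A := by rw [hG.mul_mul_self, hH.symm_right]
  calc G = G * (A * G) := by rw [← Matrix.mul_assoc, hG.mul_mul_inv]
    _ = G * A * H := by rw [h1, Matrix.mul_assoc]
    _ = H := by rw [h2, hH.mul_mul_inv]

theorem exists_isMoorePenrose_of_isSymm {α : Type*} [Fintype α]
    (S : Matrix α α ℝ) (hS : Sᵀ = S) : ∃ G, Gᵀ = G ∧ IsMoorePenrose S G := by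
  classical
  have hS' : S.IsHermitian := by
    rw [Matrix.IsHermitian, Matrix.conjTranspose_eq_transpose_of_trivial]; exact hS
  set U : Matrix α α ℝ := (hS'.eigenvectorUnitary : Matrix α α ℝ) with hU
  set d : α → ℝ := hS'.eigenvalues with hd
  have hUU : Uᵀ * U = 1 := by
    have := (Matrix.mem_unitaryGroup_iff' (A := U)).1 hS'.eigenvectorUnitary.2
    rwa [Matrix.star_eq_conjTranspose, Matrix.conjTranspose_eq_transpose_of_trivial] at this
  have hspec : S = U * diagonal d * Uᵀ := by
    have h := hS'.spectral_theorem
    rw [Unitary.conjStarAlgAut_apply] at h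
    rw [h]
    simp [hU, hd, Matrix.star_eq_conjTranspose]
  have key : ∀ X Y : Matrix α α ℝ, U * X * Uᵀ * (U * Y * Uᵀ) = U * (X * Y) * Uᵀ := by
    intro X Y
    calc U * X * Uᵀ * (U * Y * Uᵀ) = U * X * (Uᵀ * U) * Y * Uᵀ := by simp only [Matrix.mul_assoc]
      _ = _ := by rw [hUU]; simp only [Matrix.mul_assoc, Matrix.one_mul]
  have htr : ∀ v : α → ℝ, (U * diagonal v * Uᵀ)ᵀ = U * diagonal v * Uᵀ := by
    intro v
    simp [Matrix.transpose_mul, Matrix.mul_assoc]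
  refine ⟨U * diagonal (fun i => (d i)⁻¹) * Uᵀ, htr _, ?_, ?_, ?_, ?_⟩
  · have h : (fun i => d i * (d i)⁻¹ * d i) = d := by
      funext i; by_cases hi : d i = 0 <;> simp [hi]
    rw [hspec, key, key, diagonal_mul_diagonal, diagonal_mul_diagonal, h]
  · have h : (fun i => (d i)⁻¹ * d i * (d i)⁻¹) = fun i => (d i)⁻¹ := by
      funext i; by_cases hi : d i = 0 <;> simp [hi]
    rw [hspec, key, key, diagonal_mul_diagonal, diagonal_mul_diagonal, h]
  · rw [hspec, key, diagonal_mul_diagonal, htr]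
  · rw [hspec, key, diagonal_mul_diagonal, htr]

theorem exists_isMoorePenrose {α β : Type*} [Fintype α] [Fintype β]
    (A : Matrix α β ℝ) : ∃ G, IsMoorePenrose A G := by
  classical
  obtain ⟨H, hHt, hH⟩ := exists_isMoorePenrose_of_isSymm (Aᵀ * A) (by simp)
  have hzero : A * (H * (Aᵀ * A) - 1) = 0 := by
    rw [← Matrix.conjTranspose_mul_self_eq_zero, Matrix.conjTranspose_eq_transpose_of_trivial,
      Matrix.transpose_mul]
    have h : Aᵀ * (A * (H * (Aᵀ * A) - 1)) = 0 := by
      rw [← Matrix.mul_assoc, Matrix.mul_sub, ← Matrix.mul_assoc, hH.mul_mul_self, Matrix.mul_one,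
        sub_self]
    rw [Matrix.mul_assoc, h, Matrix.mul_zero]
  refine ⟨H * Aᵀ, ?_, ?_, ?_, ?_⟩
  · rw [Matrix.mul_sub, Matrix.mul_one, sub_eq_zero] at hzero
    rw [Matrix.mul_assoc, Matrix.mul_assoc, hzero]
  · calc H * Aᵀ * A * (H * Aᵀ) = (H * (Aᵀ * A) * H) * Aᵀ := by simp only [Matrix.mul_assoc]
      _ = H * Aᵀ := by rw [hH.mul_mul_inv]
  · simp [Matrix.transpose_mul, hHt, Matrix.mul_assoc]
  · rw [Matrix.mul_assoc, hH.symm_right]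

/-- The Moore-Penrose inverse `A⁺`. -/
noncomputable def pinv {α β : Type*} [Fintype α] [Fintype β] (A : Matrix α β ℝ) :
    Matrix β α ℝ :=
  Classical.choose (exists_isMoorePenrose A)

theorem isMoorePenrose_pinv {α β : Type*} [Fintype α] [Fintype β] (A : Matrix α β ℝ) :
    IsMoorePenrose A (pinv A) :=
  Classical.choose_spec (exists_isMoorePenrose A)

end MoorePenrose

/-! ### Items, pairs, triads, and the linear and cyclical design matrices -/

section Design

/-- The pairs `(i, j)` with `i < j`; they index the preference profile `ν`. -/
abbrev Edge (K : ℕ) : Type := {e : Fin K × Fin K // e.1 < e.2}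

/-- The triads `(i, j, k)` with `i < j < k`. -/
abbrev Triad (K : ℕ) : Type :=
  {t : Fin K × Fin K × Fin K // t.1 < t.2.1 ∧ t.2.1 < t.2.2}

/-- The matrix `B`: `b_k(s,t) = 𝟙(s = k) - 𝟙(t = k)`, so that `(B μ)_{st} = μ_s - μ_t`. -/
def linMatrix (K : ℕ) : Matrix (Edge K) (Fin K) ℝ :=
  Matrix.of fun e k => (if e.1.1 = k then 1 else 0) - (if e.1.2 = k then 1 else 0)

/-- The matrix `C`, whose columns are the cyclical vectors `c_(i,j,k)`, `i < j < k`. -/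
def cycMatrix (K : ℕ) : Matrix (Edge K) (Triad K) ℝ :=
  Matrix.of fun e t =>
    let i := t.1.1
    let j := t.1.2.1
    let k := t.1.2.2
    (if e.1 = (i, j) ∨ e.1 = (j, k) ∨ e.1 = (k, i) then 1 else 0) -
      (if e.1 = (j, i) ∨ e.1 = (k, j) ∨ e.1 = (i, k) then 1 else 0)

/-- The sub-matrix `C_s` of `C` made of the columns of the triads in `s`. -/
def cycSubMatrix {K : ℕ} (s : Finset (Triad K)) : Matrix (Edge K) s ℝ :=
  (cycMatrix K).submatrix id (fun t => t.1)

/-- The set of triads used by `γ`, i.e. those with non-zero coefficient. -/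
noncomputable def triadsOf {K : ℕ} (γ : Triad K → ℝ) : Finset (Triad K) :=
  Finset.univ.filter fun t => γ t ≠ 0

/-- `γ` is a minimal model of the cyclical component `νcyc`: it represents `νcyc = C γ`, and no
representation of `νcyc` has fewer non-zero coefficients. -/
def IsMinimalModel {K : ℕ} (νcyc : Edge K → ℝ) (γ : Triad K → ℝ) : Prop :=
  cycMatrix K *ᵥ γ = νcyc ∧
    ∀ γ' : Triad K → ℝ, cycMatrix K *ᵥ γ' = νcyc → (triadsOf γ).card ≤ (triadsOf γ').card

end Design

/-! ### Observations and least squares -/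

section Estimation

variable {K : ℕ}

/-- The observations of a design with `n e` comparisons of the pair `e`. -/
abbrev Obs (n : Edge K → ℕ) : Type := Σ e : Edge K, Fin (n e)

/-- The total number of comparisons. -/
def totalCount (n : Edge K → ℕ) : ℕ := ∑ e, n e

/-- The zero-one matrix `L` which sends `ν` to the vector of the means of the observations. -/
def obsMatrix (n : Edge K → ℕ) : Matrix (Obs n) (Edge K) ℝ :=
  Matrix.of fun o e => if o.1 = e then 1 else 0

/-- The number `n_ij = n_ji` of comparisons between the items `i` and `j` (zero if `i = j`). -/
def pairCount (n : Edge K → ℕ) (i j : Fin K) : ℕ :=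
  if h : i < j then n ⟨(i, j), h⟩ else if h : j < i then n ⟨(j, i), h⟩ else 0

/-- The Laplacian `N` of the comparison graph weighted by the numbers of comparisons. -/
def laplacian (n : Edge K → ℕ) : Matrix (Fin K) (Fin K) ℝ :=
  Matrix.diagonal (fun i => ∑ j, (pairCount n i j : ℝ)) -
    Matrix.of fun i j => (pairCount n i j : ℝ)

/-- The sum of squares `Q(μ, γ_s) = ‖Y - L (B μ + C_s γ_s)‖²`. -/
noncomputable def sumSq (s : Finset (Triad K)) (n : Edge K → ℕ) (y : Obs n → ℝ)
    (μ : Fin K → ℝ) (γs : s → ℝ) : ℝ :=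
  ∑ o, (y o - (obsMatrix n *ᵥ (linMatrix K *ᵥ μ + cycSubMatrix s *ᵥ γs)) o) ^ 2

/-- `(μ, γ_s)` is a least squares estimate: it minimizes `Q` subject to `∑ i, μ i = 0`. -/
def IsLSE (s : Finset (Triad K)) (n : Edge K → ℕ) (y : Obs n → ℝ)
    (μ : Fin K → ℝ) (γs : s → ℝ) : Prop :=
  ∑ i, μ i = 0 ∧
    ∀ (μ' : Fin K → ℝ) (γs' : s → ℝ), ∑ i, μ' i = 0 → sumSq s n y μ γs ≤ sumSq s n y μ' γs'

/-- The matrix `I - L B N⁺ Bᵀ Lᵀ`. -/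
noncomputable def residMatrix (n : Edge K → ℕ) : Matrix (Obs n) (Obs n) ℝ :=
  1 - obsMatrix n * linMatrix K * pinv (laplacian n) * (linMatrix K)ᵀ * (obsMatrix n)ᵀ

/-- `(C_sᵀ Lᵀ (I - L B N⁺ Bᵀ Lᵀ) L C_s)⁺ C_sᵀ Lᵀ (I - L B N⁺ Bᵀ Lᵀ) Y`. -/
noncomputable def gammaHat (s : Finset (Triad K)) (n : Edge K → ℕ) (y : Obs n → ℝ) : s → ℝ :=
  (pinv ((cycSubMatrix s)ᵀ * (obsMatrix n)ᵀ * residMatrix n * obsMatrix n * cycSubMatrix s) *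
    ((cycSubMatrix s)ᵀ * (obsMatrix n)ᵀ * residMatrix n)) *ᵥ y

/-- `N⁺ Bᵀ Lᵀ (Y - L C_s γ̂_s)`. -/
noncomputable def muHat (s : Finset (Triad K)) (n : Edge K → ℕ) (y : Obs n → ℝ) : Fin K → ℝ :=
  (pinv (laplacian n) * (linMatrix K)ᵀ * (obsMatrix n)ᵀ) *ᵥ
    (y - (obsMatrix n * cycSubMatrix s) *ᵥ gammaHat s n y)

/-- The stacked coefficient vector `(μ, γ_s)` in Euclidean space. -/
noncomputable def coefVec {s : Finset (Triad K)} (μ : Fin K → ℝ) (γs : s → ℝ) :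
    EuclideanSpace ℝ (Fin K ⊕ s) :=
  WithLp.toLp 2 (Sum.elim μ γs)

/-- The stacked estimator `(μ̂, γ̂_s)`. -/
noncomputable def estimator (s : Finset (Triad K)) (n : Edge K → ℕ) (y : Obs n → ℝ) :
    EuclideanSpace ℝ (Fin K ⊕ s) :=
  coefVec (muHat s n y) (gammaHat s n y)

/-- The block matrix with blocks `Bᵀ Ξ B`, `Bᵀ Ξ C_s`, `C_sᵀ Ξ B`, `C_sᵀ Ξ C_s`. -/
noncomputable def gramMatrix (s : Finset (Triad K)) (Ξ : Matrix (Edge K) (Edge K) ℝ) :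
    Matrix (Fin K ⊕ s) (Fin K ⊕ s) ℝ :=
  Matrix.fromBlocks
    ((linMatrix K)ᵀ * Ξ * linMatrix K) ((linMatrix K)ᵀ * Ξ * cycSubMatrix s)
    ((cycSubMatrix s)ᵀ * Ξ * linMatrix K) ((cycSubMatrix s)ᵀ * Ξ * cycSubMatrix s)

/-- The sandwich covariance `σ² G⁺ (B, C_s)ᵀ Ξ (B, C_s) G⁺`, where `Ξ` is the diagonal matrix
with entries `θ` and `G` is the block matrix `gramMatrix s Ξ`. -/
noncomputable def asympCov (s : Finset (Triad K)) (θ : Edge K → ℝ) (σ : ℝ) :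
    Matrix (Fin K ⊕ s) (Fin K ⊕ s) ℝ :=
  σ ^ 2 • (pinv (gramMatrix s (Matrix.diagonal θ)) *
    (Matrix.fromCols (linMatrix K) (cycSubMatrix s))ᵀ * Matrix.diagonal θ *
    Matrix.fromCols (linMatrix K) (cycSubMatrix s) *
    pinv (gramMatrix s (Matrix.diagonal θ)))

end Estimation

/-! ### The statistical model -/

section Probability

variable {Ω : Type*} [MeasurableSpace Ω]

/-- The family `ε` is independent and identically distributed, with mean zero and finite
variance `σ ^ 2`. -/
structure IIDErrors {ι : Type*} (ε : ι → Ω → ℝ) (σ : ℝ) (P : Measure Ω) : Prop where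
  indep : iIndepFun ε P
  identDistrib : ∀ a b, IdentDistrib (ε a) (ε b) P P
  memLp_two : ∀ a, MemLp (ε a) 2 P
  mean_eq_zero : ∀ a, ∫ ω, ε a ω ∂P = 0
  variance_eq : ∀ a, Var[ε a; P] = σ ^ 2

/-- The vector of outcomes `Y_ijk = ν_ij + ε_ijk`. -/
def response {K : ℕ} (ν : Edge K → ℝ) (n : Edge K → ℕ) (ε : Obs n → Ω → ℝ) (ω : Ω) :
    Obs n → ℝ :=
  fun o => ν o.1 + ε o ω

/-- The errors of a design with `n e` comparisons of the pair `e`: the first `n e` members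
of the error sequence of each pair `e`. -/
def firstErrors {K : ℕ} (ε : Edge K × ℕ → Ω → ℝ) (n : Edge K → ℕ) : Obs n → Ω → ℝ :=
  fun o => ε (o.1, (o.2 : ℕ))

end Probability

end PairedComparison

/-!
Write `X = (B, C_s)` and `u = (1, 0)`. A minimal model uses linearly independent columns of `C`
(`cycSubMatrix_mulVec_injective`), and these are orthogonal to the column space of `B`. Hence the
kernel of `X` is spanned by `u`, and the constraint `∑ i, μ i = 0`, which says that `(μ, γ_s)` is
orthogonal to `u`, identifies the coefficients (`eq_zero_of_designMatrix_mulVec`).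

For positive weights `w` the normal equations `Xᵀ diag(w) X β = Xᵀ z`, `u ⬝ β = 0`, therefore have
a unique solution. It is `A_w z` with `A_w = (Xᵀ diag(w) X + u uᵀ)⁻¹ Xᵀ` (`solMatrix`), and `A_w` is
also `(Xᵀ diag(w) X)⁺ Xᵀ`. The two-stage formulas for `(μ̂, γ̂_s)` solve these equations with
`w = n` and `z = Lᵀ Y`, because `V Vᵀ (V Vᵀ)⁺ V = V` for every matrix `V`; this is used for
`V = Bᵀ Lᵀ`, where `V Vᵀ` is the graph Laplacian, and for `V = C_sᵀ Lᵀ R`, with `R` the residual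
projection. The least-squares claim is then Pythagoras (`sumSq_eq_add`), and
`(μ̂, γ̂_s) - (μ, γ_s) = A_n Lᵀ ε`, which gives unbiasedness.

Consistency follows from Markov's inequality and a bound of the squared estimation error by
`C (∑ 1 / n_e) (∑ z_e² / n_e)`, where `z = Lᵀ ε` (`exists_norm_solMatrix_sq_le`): the second factor
has bounded expectation and the first tends to zero. No comparison of the rates at which the `n_e`
grow is needed.

For asymptotic normality, `A_n` equals `A_{n/N} / N`, where `N = ∑ n_e`, and `A` is continuous at
`θ`. The characteristic function of the rescaled error at `t` is a product of powers
`φ(c_e) ^ n_e` with `n_e c_e² → θ_e (A_θᵀ t)_e²`; the second-order expansion of `φ`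
(`tendsto_charFun_pow`) and Lévy's convergence theorem conclude.
-/

namespace PairedComparison

/-! ### The Moore-Penrose inverse of a symmetric matrix -/

section MoorePenrose

variable {α β : Type*} [Fintype α]

theorem transpose_pinv_of_isSymm {S : Matrix α α ℝ} (hS : Sᵀ = S) : (pinv S)ᵀ = pinv S := by
  obtain ⟨G, hGt, hG⟩ := exists_isMoorePenrose_of_isSymm S hS
  rw [(isMoorePenrose_pinv S).unique hG, hGt]

theorem mul_pinv_comm_of_isSymm {S : Matrix α α ℝ} (hS : Sᵀ = S) :
    S * pinv S = pinv S * S := by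
  rw [← (isMoorePenrose_pinv S).symm_left, transpose_mul, hS, transpose_pinv_of_isSymm hS]

/-- For symmetric `S`, the projection `S S⁺` fixes every column of `V` as soon as the columns
of `V` are orthogonal to the kernel of `S`. -/
theorem mul_pinv_mul_cancel {S : Matrix α α ℝ} (hS : Sᵀ = S) {V : Matrix α β ℝ}
    (hV : ∀ x, S *ᵥ x = 0 → Vᵀ *ᵥ x = 0) : S * pinv S * V = V := by
  classical
  have h : Vᵀ * (pinv S * S - 1) = 0 := by
    refine Matrix.ext_of_mulVec_single fun i => ?_
    rw [zero_mulVec, ← mulVec_mulVec]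
    apply hV
    rw [mulVec_mulVec, Matrix.mul_sub, ← Matrix.mul_assoc, (isMoorePenrose_pinv S).mul_mul_self,
      Matrix.mul_one, sub_self, zero_mulVec]
  rw [Matrix.mul_sub, Matrix.mul_one, sub_eq_zero, ← mul_pinv_comm_of_isSymm hS] at h
  have h' := congrArg transpose h
  rwa [transpose_mul, (isMoorePenrose_pinv S).symm_left, transpose_transpose] at h'

/-- The projection `V Vᵀ (V Vᵀ)⁺` fixes the columns of `V`; no rank assumption is needed, so the
normal equations below hold for every design. -/
theorem mul_transpose_mul_pinv_mul [Fintype β] (V : Matrix α β ℝ) :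
    V * Vᵀ * pinv (V * Vᵀ) * V = V := by
  refine mul_pinv_mul_cancel (by simp) fun x hx => ?_
  have h : (Vᵀ *ᵥ x) ⬝ᵥ (Vᵀ *ᵥ x) = 0 := by
    rw [dotProduct_mulVec, vecMul_transpose, mulVec_mulVec, hx, zero_dotProduct]
  exact dotProduct_self_eq_zero.1 h

/-- The kernel of a symmetric `S` is orthogonal to the range of `S⁺`. -/
theorem vecMul_pinv_eq_zero {S : Matrix α α ℝ} (hS : Sᵀ = S) {x : α → ℝ} (hx : S *ᵥ x = 0) :
    x ᵥ* pinv S = 0 := by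
  rw [← (isMoorePenrose_pinv S).mul_mul_inv, ← mul_pinv_comm_of_isSymm hS, ← vecMul_vecMul,
    ← vecMul_vecMul]
  have : x ᵥ* S = 0 := by rw [← mulVec_transpose, hS, hx]
  simp [this]

end MoorePenrose

/-! ### The design matrices -/

section Design

variable {K : ℕ}

theorem linMatrix_mulVec (μ : Fin K → ℝ) (e : Edge K) :
    (linMatrix K *ᵥ μ) e = μ e.1.1 - μ e.1.2 := by
  simp [linMatrix, mulVec, dotProduct, sub_mul, Finset.sum_sub_distrib]

theorem cycMatrix_apply (e : Edge K) (t : Triad K) :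
    cycMatrix K e t = (if e = ⟨(t.1.1, t.1.2.1), t.2.1⟩ then 1 else 0)
      + (if e = ⟨(t.1.2.1, t.1.2.2), t.2.2⟩ then 1 else 0)
      - (if e = ⟨(t.1.1, t.1.2.2), t.2.1.trans t.2.2⟩ then 1 else 0) := by
  obtain ⟨⟨a, b⟩, hab⟩ := e
  obtain ⟨⟨i, j, k⟩, hij, hjk⟩ := t
  simp only [cycMatrix, of_apply, Prod.mk.injEq, Subtype.mk.injEq]
  dsimp only at hab hij hjk
  grind

/-- The cyclical vectors are orthogonal to the column space of `B`. -/
theorem transpose_cycMatrix_mulVec_linMatrix (μ : Fin K → ℝ) :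
    (cycMatrix K)ᵀ *ᵥ (linMatrix K *ᵥ μ) = 0 := by
  ext t
  have : ((cycMatrix K)ᵀ *ᵥ (linMatrix K *ᵥ μ)) t
      = ∑ e, cycMatrix K e t * (linMatrix K *ᵥ μ) e := rfl
  rw [this]
  simp only [cycMatrix_apply, sub_mul, add_mul, Finset.sum_sub_distrib, Finset.sum_add_distrib,
    ite_mul, one_mul, zero_mul, Finset.sum_ite_eq', Finset.mem_univ, if_true,
    linMatrix_mulVec, Pi.zero_apply]
  ring

/-- The extension by zero of a coefficient vector on `s` to all triads. -/
def extendTriads (s : Finset (Triad K)) (γs : s → ℝ) (t : Triad K) : ℝ :=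
  if h : t ∈ s then γs ⟨t, h⟩ else 0

theorem cycMatrix_mulVec_extendTriads (s : Finset (Triad K)) (γs : s → ℝ) :
    cycMatrix K *ᵥ extendTriads s γs = cycSubMatrix s *ᵥ γs := by
  ext e
  simp only [mulVec, dotProduct, cycSubMatrix, submatrix_apply, id]
  rw [← Finset.sum_subset (Finset.subset_univ s)]
  · rw [← Finset.sum_attach s]
    exact Finset.sum_congr rfl fun t _ => by simp [extendTriads]
  · intro t _ ht
    simp [extendTriads, ht]

theorem extendTriads_restrict {γ : Triad K → ℝ} {s : Finset (Triad K)} (hs : s = triadsOf γ) :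
    extendTriads s (fun t => γ t.1) = γ := by
  ext t
  by_cases ht : t ∈ s
  · simp [extendTriads, ht]
  · have : γ t = 0 := by simpa [hs, triadsOf] using ht
    simp [extendTriads, ht, this]

/-- The columns of `C` used by a minimal model are linearly independent: along a non-trivial
relation one could otherwise move `γ` until a further coefficient vanishes. -/
theorem cycSubMatrix_mulVec_injective {νcyc : Edge K → ℝ} {γ : Triad K → ℝ}
    (hγ : IsMinimalModel νcyc γ) {s : Finset (Triad K)} (hs : s = triadsOf γ) {δ : s → ℝ}
    (hδ : cycSubMatrix s *ᵥ δ = 0) : δ = 0 := by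
  by_contra hne
  obtain ⟨t, ht⟩ := Function.ne_iff.1 hne
  -- the step at which the coefficient of `t` vanishes
  set γ' : Triad K → ℝ := γ - (γ t.1 / δ t) • extendTriads s δ with hγ'
  have hC : cycMatrix K *ᵥ γ' = νcyc := by
    rw [hγ', mulVec_sub, mulVec_smul, cycMatrix_mulVec_extendTriads, hδ, smul_zero, sub_zero,
      hγ.1]
  have hsub : triadsOf γ' ⊆ s.erase t.1 := by
    intro r hr
    have hr' : γ' r ≠ 0 := by simpa [triadsOf] using hr
    rw [Finset.mem_erase]
    constructor
    · rintro rfl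
      apply hr'
      have : δ t ≠ 0 := ht
      simp [hγ', extendTriads, this]
    · by_contra hrs
      apply hr'
      have : γ r = 0 := by simpa [hs, triadsOf] using hrs
      simp [hγ', extendTriads, hrs, this]
  have h1 := (hγ.2 γ' hC).trans (Finset.card_le_card hsub)
  rw [← hs] at h1
  have h2 := Finset.card_erase_lt_of_mem t.2
  omega

/-- The design matrix `(B, C_s)`. -/
def designMatrix (s : Finset (Triad K)) : Matrix (Edge K) (Fin K ⊕ s) ℝ :=
  fromCols (linMatrix K) (cycSubMatrix s)

/-- The vector `(1, 0)`, which spans the kernel of `(B, C_s)`; the constraint `∑ i, μ i = 0`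
says that `(μ, γ_s)` is orthogonal to it. -/
def shiftVec (s : Finset (Triad K)) : Fin K ⊕ s → ℝ := Sum.elim 1 0

theorem designMatrix_mulVec_elim (s : Finset (Triad K)) (μ : Fin K → ℝ) (γs : s → ℝ) :
    designMatrix s *ᵥ Sum.elim μ γs = linMatrix K *ᵥ μ + cycSubMatrix s *ᵥ γs :=
  fromCols_mulVec_sumElim _ _ _ _

theorem shiftVec_dotProduct_elim (s : Finset (Triad K)) (μ : Fin K → ℝ) (γs : s → ℝ) :
    shiftVec s ⬝ᵥ Sum.elim μ γs = ∑ i, μ i := by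
  simp [shiftVec, dotProduct, Fintype.sum_sum_type]

theorem designMatrix_mulVec_shiftVec (s : Finset (Triad K)) :
    designMatrix s *ᵥ shiftVec s = 0 := by
  rw [shiftVec, designMatrix_mulVec_elim, mulVec_zero, add_zero]
  ext e
  simp [linMatrix_mulVec]

theorem transpose_cycSubMatrix_mulVec_linMatrix (s : Finset (Triad K)) (μ : Fin K → ℝ) :
    (cycSubMatrix s)ᵀ *ᵥ (linMatrix K *ᵥ μ) = 0 := by
  ext t
  exact congrFun (transpose_cycMatrix_mulVec_linMatrix μ) t.1

/-- If the columns of `C_s` are linearly independent, then the constraint `∑ i, μ i = 0`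
identifies the coefficients of the model `(B, C_s)`. -/
theorem eq_zero_of_designMatrix_mulVec {s : Finset (Triad K)}
    (hinj : ∀ δ : s → ℝ, cycSubMatrix s *ᵥ δ = 0 → δ = 0) {β : Fin K ⊕ s → ℝ}
    (hX : designMatrix s *ᵥ β = 0) (hu : shiftVec s ⬝ᵥ β = 0) : β = 0 := by
  obtain ⟨μ, γs, rfl⟩ : ∃ μ γs, β = Sum.elim μ γs :=
    ⟨β ∘ Sum.inl, β ∘ Sum.inr, (Sum.elim_comp_inl_inr β).symm⟩
  rw [designMatrix_mulVec_elim] at hX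
  rw [shiftVec_dotProduct_elim] at hu
  have hC : cycSubMatrix s *ᵥ γs = 0 := by
    rw [← dotProduct_self_eq_zero]
    have h : (linMatrix K *ᵥ μ) ⬝ᵥ (cycSubMatrix s *ᵥ γs) = 0 := by
      rw [dotProduct_mulVec, ← mulVec_transpose, transpose_cycSubMatrix_mulVec_linMatrix,
        zero_dotProduct]
    calc _ = (linMatrix K *ᵥ μ + cycSubMatrix s *ᵥ γs) ⬝ᵥ (cycSubMatrix s *ᵥ γs) := by
          rw [add_dotProduct, h, zero_add]
      _ = 0 := by rw [hX, zero_dotProduct]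
  rw [hC, add_zero] at hX
  have hlt : ∀ i j, i < j → μ i = μ j := fun i j hij => by
    have := congrFun hX ⟨(i, j), hij⟩
    rw [linMatrix_mulVec] at this
    exact sub_eq_zero.1 this
  have heq : ∀ i j, μ i = μ j := fun i j => by
    rcases lt_trichotomy i j with h | h | h
    · exact hlt i j h
    · rw [h]
    · exact (hlt j i h).symm
  have hμ : μ = 0 := by
    ext i
    have : ∑ j, μ j = K * μ i := by simp [fun j => heq j i]
    rw [hu] at this
    have hK : (K : ℝ) ≠ 0 := by exact_mod_cast (Fin.pos i).ne'
    simpa [hK] using this.symm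
  rw [hμ, hinj γs hC]
  ext (i | i) <;> rfl

end Design

/-! ### Weighted normal equations -/

section NormalEquations

variable {K : ℕ} {s : Finset (Triad K)}

theorem gramMatrix_eq (s : Finset (Triad K)) (Ξ : Matrix (Edge K) (Edge K) ℝ) :
    gramMatrix s Ξ = (designMatrix s)ᵀ * Ξ * designMatrix s := by
  rw [designMatrix, transpose_fromCols, fromRows_mul, fromRows_mul_fromCols, gramMatrix]

theorem transpose_gramMatrix (w : Edge K → ℝ) :
    (gramMatrix s (diagonal w))ᵀ = gramMatrix s (diagonal w) := by
  rw [gramMatrix_eq]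
  simp [Matrix.mul_assoc]

/-- The matrix of the map which sends `z` to the solution of the normal equations
`(B, C_s)ᵀ diag(w) (B, C_s) β = (B, C_s)ᵀ z` orthogonal to `u = (1, 0)`, for positive `w` and
linearly independent columns of `C_s`. Adding `u uᵀ` to the Gram matrix, whose kernel `u` spans,
makes it invertible and shows that the solution is continuous in `w`. -/
noncomputable def solMatrix (s : Finset (Triad K)) (w : Edge K → ℝ) :
    Matrix (Fin K ⊕ s) (Edge K) ℝ :=
  (gramMatrix s (diagonal w) + vecMulVec (shiftVec s) (shiftVec s))⁻¹ * (designMatrix s)ᵀ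

theorem gramMatrix_mulVec (w : Edge K → ℝ) (β : Fin K ⊕ s → ℝ) :
    gramMatrix s (diagonal w) *ᵥ β = (designMatrix s)ᵀ *ᵥ (w * designMatrix s *ᵥ β) := by
  rw [gramMatrix_eq, ← mulVec_mulVec, ← mulVec_mulVec]
  congr 1
  ext e
  simp [mulVec_diagonal]

theorem dotProduct_gramMatrix_mulVec (w : Edge K → ℝ) (β : Fin K ⊕ s → ℝ) :
    β ⬝ᵥ gramMatrix s (diagonal w) *ᵥ β = ∑ e, w e * (designMatrix s *ᵥ β) e ^ 2 := by
  rw [gramMatrix_mulVec, dotProduct_mulVec, vecMul_transpose]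
  exact Finset.sum_congr rfl fun e _ => by simp only [Pi.mul_apply]; ring

theorem designMatrix_mulVec_eq_zero_of_gramMatrix {w : Edge K → ℝ} (hw : ∀ e, 0 < w e)
    {β : Fin K ⊕ s → ℝ} (h : β ⬝ᵥ gramMatrix s (diagonal w) *ᵥ β ≤ 0) :
    designMatrix s *ᵥ β = 0 := by
  rw [dotProduct_gramMatrix_mulVec] at h
  have hnn : ∀ e ∈ Finset.univ, 0 ≤ w e * (designMatrix s *ᵥ β) e ^ 2 :=
    fun e _ => mul_nonneg (hw e).le (sq_nonneg _)
  have h0 := (Finset.sum_eq_zero_iff_of_nonneg hnn).1 (h.antisymm (Finset.sum_nonneg hnn))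
  ext e
  have := h0 e (Finset.mem_univ e)
  simpa [(hw e).ne'] using this

theorem vecMul_shiftVec_transpose_designMatrix :
    shiftVec s ᵥ* (designMatrix s)ᵀ = 0 := by
  rw [vecMul_transpose, designMatrix_mulVec_shiftVec]

theorem isUnit_det_gramMatrix_add (hinj : ∀ δ : s → ℝ, cycSubMatrix s *ᵥ δ = 0 → δ = 0)
    {w : Edge K → ℝ} (hw : ∀ e, 0 < w e) :
    IsUnit (gramMatrix s (diagonal w) + vecMulVec (shiftVec s) (shiftVec s)).det := by
  rw [isUnit_iff_ne_zero]
  intro hdet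
  obtain ⟨β, hβ, h0⟩ := exists_mulVec_eq_zero_iff.2 hdet
  apply hβ
  have h1 : β ⬝ᵥ gramMatrix s (diagonal w) *ᵥ β + (shiftVec s ⬝ᵥ β) ^ 2 = 0 := by
    have h2 := congrArg (β ⬝ᵥ ·) h0
    simp only [add_mulVec, dotProduct_add, dotProduct_zero, vecMulVec_mulVec] at h2
    rw [← h2, dotProduct_smul, dotProduct_comm β (shiftVec s)]
    simp [sq]
  have h3 : 0 ≤ β ⬝ᵥ gramMatrix s (diagonal w) *ᵥ β := by
    rw [dotProduct_gramMatrix_mulVec]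
    exact Finset.sum_nonneg fun e _ => mul_nonneg (hw e).le (sq_nonneg _)
  refine eq_zero_of_designMatrix_mulVec hinj
    (designMatrix_mulVec_eq_zero_of_gramMatrix hw ?_) ?_
  · nlinarith [sq_nonneg (shiftVec s ⬝ᵥ β)]
  · have : (shiftVec s ⬝ᵥ β) ^ 2 = 0 := by nlinarith [sq_nonneg (shiftVec s ⬝ᵥ β)]
    exact pow_eq_zero_iff two_ne_zero |>.1 this

theorem eq_solMatrix_mulVec_iff (hinj : ∀ δ : s → ℝ, cycSubMatrix s *ᵥ δ = 0 → δ = 0)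
    {w : Edge K → ℝ} (hw : ∀ e, 0 < w e) {β : Fin K ⊕ s → ℝ} {z : Edge K → ℝ} :
    β = solMatrix s w *ᵥ z ↔
      gramMatrix s (diagonal w) *ᵥ β = (designMatrix s)ᵀ *ᵥ z ∧ shiftVec s ⬝ᵥ β = 0 := by
  have hdet := isUnit_det_gramMatrix_add hinj hw
  set M := gramMatrix s (diagonal w) + vecMulVec (shiftVec s) (shiftVec s) with hM
  have h1 : β = solMatrix s w *ᵥ z ↔ M *ᵥ β = (designMatrix s)ᵀ *ᵥ z := by
    rw [solMatrix, ← hM, ← mulVec_mulVec]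
    constructor
    · rintro rfl
      rw [mulVec_mulVec, mul_nonsing_inv _ hdet, one_mulVec]
    · intro h
      rw [← h, mulVec_mulVec, nonsing_inv_mul _ hdet, one_mulVec]
  have h2 : M *ᵥ β = gramMatrix s (diagonal w) *ᵥ β + (shiftVec s ⬝ᵥ β) • shiftVec s := by
    rw [hM, add_mulVec, vecMulVec_mulVec]
    simp
  rw [h1, h2]
  refine ⟨fun h => ?_, fun h => by rw [h.1, h.2, zero_smul, add_zero]⟩
  have hu : shiftVec s ⬝ᵥ β = 0 := by
    -- `(1, 0)` is orthogonal to the range of the Gram matrix and to that of `(B, C_s)ᵀ`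
    have h3 := congrArg (shiftVec s ⬝ᵥ ·) h
    simp only [dotProduct_add, gramMatrix_mulVec, dotProduct_mulVec (shiftVec s),
      vecMul_shiftVec_transpose_designMatrix, zero_dotProduct, zero_add, dotProduct_smul,
      smul_eq_mul] at h3
    rcases mul_eq_zero.1 h3 with h4 | h4
    · exact h4
    · rw [dotProduct_self_eq_zero.1 h4, zero_dotProduct]
  rw [hu, zero_smul, add_zero] at h
  exact ⟨h, hu⟩

theorem pinv_gramMatrix_mul_transpose (hinj : ∀ δ : s → ℝ, cycSubMatrix s *ᵥ δ = 0 → δ = 0)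
    {w : Edge K → ℝ} (hw : ∀ e, 0 < w e) :
    pinv (gramMatrix s (diagonal w)) * (designMatrix s)ᵀ = solMatrix s w := by
  refine Matrix.ext_of_mulVec_single fun e => ?_
  rw [eq_solMatrix_mulVec_iff hinj hw]
  constructor
  · rw [mulVec_mulVec, ← Matrix.mul_assoc, mul_pinv_mul_cancel (transpose_gramMatrix w)]
    intro x hx
    rw [transpose_transpose]
    exact designMatrix_mulVec_eq_zero_of_gramMatrix hw (by rw [hx, dotProduct_zero])
  · rw [← mulVec_mulVec, dotProduct_mulVec, vecMul_pinv_eq_zero (transpose_gramMatrix w),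
      zero_dotProduct]
    rw [gramMatrix_mulVec, designMatrix_mulVec_shiftVec, mul_zero, mulVec_zero]

theorem solMatrix_mulVec_mul_designMatrix
    (hinj : ∀ δ : s → ℝ, cycSubMatrix s *ᵥ δ = 0 → δ = 0)
    {w : Edge K → ℝ} (hw : ∀ e, 0 < w e) {β : Fin K ⊕ s → ℝ} (hu : shiftVec s ⬝ᵥ β = 0) :
    solMatrix s w *ᵥ (w * designMatrix s *ᵥ β) = β :=
  ((eq_solMatrix_mulVec_iff hinj hw).2 ⟨gramMatrix_mulVec w β, hu⟩).symm

/-- Homogeneity: only the relative weights matter, up to a scalar factor. -/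
theorem solMatrix_smul (hinj : ∀ δ : s → ℝ, cycSubMatrix s *ᵥ δ = 0 → δ = 0)
    {w : Edge K → ℝ} (hw : ∀ e, 0 < w e) {c : ℝ} (hc : 0 < c) :
    solMatrix s (c • w) = c⁻¹ • solMatrix s w := by
  refine Matrix.ext_of_mulVec_single fun e => Eq.symm ?_
  have hcw : ∀ e, 0 < (c • w) e := fun e => mul_pos hc (hw e)
  rw [eq_solMatrix_mulVec_iff hinj hcw]
  obtain ⟨h1, h2⟩ := (eq_solMatrix_mulVec_iff hinj hw (z := Pi.single e 1)).1 rfl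
  rw [smul_mulVec, dotProduct_smul, h2, smul_zero, mulVec_smul, ← h1]
  refine ⟨?_, rfl⟩
  simp only [gramMatrix_mulVec, smul_mul_assoc, mulVec_smul]
  rw [smul_smul, inv_mul_cancel₀ hc.ne', one_smul]

theorem continuousAt_solMatrix (hinj : ∀ δ : s → ℝ, cycSubMatrix s *ᵥ δ = 0 → δ = 0)
    {w : Edge K → ℝ} (hw : ∀ e, 0 < w e) : ContinuousAt (solMatrix s) w := by
  unfold solMatrix
  have hM : Continuous fun w : Edge K → ℝ =>
      gramMatrix s (diagonal w) + vecMulVec (shiftVec s) (shiftVec s) := by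
    simp only [gramMatrix_eq]
    fun_prop
  have hinv : ContinuousAt (fun M : Matrix (Fin K ⊕ s) (Fin K ⊕ s) ℝ => M⁻¹)
      (gramMatrix s (diagonal w) + vecMulVec (shiftVec s) (shiftVec s)) :=
    continuousAt_matrix_inv _
      (NormedRing.inverse_continuousAt (isUnit_det_gramMatrix_add hinj hw).unit)
  have hcomp : ContinuousAt (fun w : Edge K → ℝ =>
      (gramMatrix s (diagonal w) + vecMulVec (shiftVec s) (shiftVec s))⁻¹) w :=
    ContinuousAt.comp (g := fun M : Matrix (Fin K ⊕ s) (Fin K ⊕ s) ℝ => M⁻¹) hinv hM.continuousAt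
  have hmul : Continuous fun M : Matrix (Fin K ⊕ s) (Fin K ⊕ s) ℝ => M * (designMatrix s)ᵀ := by
    fun_prop
  exact hmul.continuousAt.comp hcomp

/-- The energy estimate: the fitted values of noise `z` satisfy
`∑ w (Xδ)² ≤ ∑ z² / w`. -/
theorem sum_mul_designMatrix_solMatrix_sq_le
    (hinj : ∀ δ : s → ℝ, cycSubMatrix s *ᵥ δ = 0 → δ = 0)
    {w : Edge K → ℝ} (hw : ∀ e, 0 < w e) (z : Edge K → ℝ) :
    ∑ e, w e * (designMatrix s *ᵥ solMatrix s w *ᵥ z) e ^ 2 ≤ ∑ e, z e ^ 2 / w e := by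
  set δ := solMatrix s w *ᵥ z with hδ
  have h1 : ∑ e, w e * (designMatrix s *ᵥ δ) e ^ 2 = ∑ e, (designMatrix s *ᵥ δ) e * z e := by
    rw [← dotProduct_gramMatrix_mulVec, ((eq_solMatrix_mulVec_iff hinj hw).1 hδ).1,
      dotProduct_mulVec, vecMul_transpose]
    rfl
  have h2 : ∑ e, (designMatrix s *ᵥ δ) e * z e ≤
      ∑ e, (w e * (designMatrix s *ᵥ δ) e ^ 2 + z e ^ 2 / w e) / 2 := by
    refine Finset.sum_le_sum fun e _ => ?_
    have h3 : 0 ≤ (w e * (designMatrix s *ᵥ δ) e - z e) ^ 2 / w e :=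
      div_nonneg (sq_nonneg _) (hw e).le
    have h4 : (w e * (designMatrix s *ᵥ δ) e - z e) ^ 2 / w e =
        w e * (designMatrix s *ᵥ δ) e ^ 2 - 2 * ((designMatrix s *ᵥ δ) e * z e)
          + z e ^ 2 / w e := by
      have := (hw e).ne'
      field_simp
      ring
    linarith
  rw [← Finset.sum_div, Finset.sum_add_distrib] at h2
  linarith

end NormalEquations

/-! ### The explicit estimator -/

section Estimator

variable {K : ℕ}

theorem transpose_obsMatrix_mulVec (n : Edge K → ℕ) (y : Obs n → ℝ) (e : Edge K) :
    ((obsMatrix n)ᵀ *ᵥ y) e = ∑ k, y ⟨e, k⟩ := by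
  simp only [mulVec, dotProduct, transpose_apply, obsMatrix, of_apply, Fintype.sum_sigma]
  rw [Finset.sum_eq_single e]
  · simp
  · intro b _ hb
    simp [hb]
  · simp

theorem obsMatrix_mulVec (n : Edge K → ℕ) (x : Edge K → ℝ) (o : Obs n) :
    (obsMatrix n *ᵥ x) o = x o.1 := by
  simp [obsMatrix, mulVec, dotProduct]

theorem transpose_obsMatrix_mulVec_obsMatrix (n : Edge K → ℕ) (x : Edge K → ℝ) :
    (obsMatrix n)ᵀ *ᵥ (obsMatrix n *ᵥ x) = (fun e => (n e : ℝ)) * x := by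
  ext e
  rw [transpose_obsMatrix_mulVec]
  simp [obsMatrix_mulVec]

theorem transpose_obsMatrix_mul_obsMatrix (n : Edge K → ℕ) :
    (obsMatrix n)ᵀ * obsMatrix n = diagonal fun e => (n e : ℝ) := by
  refine Matrix.ext_of_mulVec_single fun e => ?_
  rw [← mulVec_mulVec, transpose_obsMatrix_mulVec_obsMatrix]
  ext e'
  simp [mulVec_diagonal]

theorem pairCount_comm (n : Edge K → ℕ) (i j : Fin K) : pairCount n i j = pairCount n j i := by
  unfold pairCount
  rcases lt_trichotomy i j with h | h | h
  · simp [h, h.not_gt]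
  · simp [h]
  · simp [h, h.not_gt]

/-- A weighted sum over the pairs as a double sum over the items. -/
theorem sum_edge_mul (n : Edge K → ℕ) (f : Fin K → Fin K → ℝ) :
    ∑ e : Edge K, (n e : ℝ) * f e.1.1 e.1.2 =
      ∑ i, ∑ j, if i < j then (pairCount n i j : ℝ) * f i j else 0 := by
  rw [← Fintype.sum_prod_type', ← Finset.sum_filter]
  refine Finset.sum_bij (fun e _ => e.1) ?_ ?_ ?_ ?_
  · intro e _
    simpa using e.2
  · intro a _ b _ h
    exact Subtype.ext h
  · intro p hp
    exact ⟨⟨p, by simpa using hp⟩, Finset.mem_univ _, rfl⟩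
  · rintro ⟨⟨i, j⟩, h⟩ _
    dsimp only at h
    simp [pairCount, h]

/-- The weighted graph Laplacian is the Gram matrix of `L B`. -/
theorem laplacian_eq (n : Edge K → ℕ) :
    laplacian n = (linMatrix K)ᵀ * (obsMatrix n)ᵀ * ((linMatrix K)ᵀ * (obsMatrix n)ᵀ)ᵀ := by
  have h : (linMatrix K)ᵀ * (obsMatrix n)ᵀ * ((linMatrix K)ᵀ * (obsMatrix n)ᵀ)ᵀ =
      (linMatrix K)ᵀ * diagonal (fun e => (n e : ℝ)) * linMatrix K := by
    rw [transpose_mul, transpose_transpose, transpose_transpose,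
      ← transpose_obsMatrix_mul_obsMatrix]
    simp only [Matrix.mul_assoc]
  rw [h]
  ext k l
  have h1 : ((linMatrix K)ᵀ * diagonal (fun e => (n e : ℝ)) * linMatrix K) k l =
      ∑ e : Edge K, (n e : ℝ) * (((if e.1.1 = k then 1 else 0) - (if e.1.2 = k then 1 else 0)) *
        ((if e.1.1 = l then 1 else 0) - (if e.1.2 = l then 1 else 0))) := by
    rw [mul_apply]
    refine Finset.sum_congr rfl fun e _ => ?_
    simp only [mul_diagonal, transpose_apply, linMatrix, of_apply]
    ring
  have hdiag : ∀ i, pairCount n i i = 0 := fun i => by simp [pairCount]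
  have h2 : ∀ i j : Fin K, (if i < j then (pairCount n i j : ℝ) *
      ((((if i = k then 1 else 0) - (if j = k then 1 else 0)) *
        ((if i = l then 1 else 0) - (if j = l then 1 else 0)))) else 0) =
      (if i = k then (if k = l then (if k < j then (pairCount n k j : ℝ) else 0) else 0) else 0)
      - (if i = k then (if j = l then (if k < l then (pairCount n k l : ℝ) else 0) else 0) else 0)
      - (if j = k then (if i = l then (if l < k then (pairCount n l k : ℝ) else 0) else 0) else 0)
      + (if j = k then (if k = l then (if i < k then (pairCount n i k : ℝ) else 0) else 0)
          else 0) := by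
    intro i j
    grind
  -- of the four products of indicators, two give the off-diagonal entries and two the degrees
  rw [h1, sum_edge_mul n fun i j => ((if i = k then 1 else 0) - (if j = k then 1 else 0)) *
        ((if i = l then 1 else 0) - (if j = l then 1 else 0))]
  simp only [h2, Finset.sum_add_distrib, Finset.sum_sub_distrib]
  have h3 : ∑ j, (pairCount n k j : ℝ) =
      ∑ j, (if k < j then (pairCount n k j : ℝ) else 0)
        + ∑ j, (if j < k then (pairCount n j k : ℝ) else 0) := by
    rw [← Finset.sum_add_distrib]
    refine Finset.sum_congr rfl fun j _ => ?_
    rcases lt_trichotomy k j with hj | hj | hj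
    · simp [hj, hj.not_gt]
    · simp [← hj, hdiag]
    · simp [hj, hj.not_gt, pairCount_comm n k j]
  by_cases hkl : k = l
  · subst hkl
    simp only [laplacian, hdiag, h3, Matrix.sub_apply, diagonal_apply_eq, of_apply, Nat.cast_zero,
      if_true, lt_irrefl, ite_self, Finset.sum_const_zero, sub_zero,
      Finset.sum_ite_eq', Finset.mem_univ]
    rw [Finset.sum_comm]
    simp
  · rcases lt_or_gt_of_ne hkl with hlt | hlt
    · simp [laplacian, hkl, hlt, hlt.not_gt]
    · simp [laplacian, hkl, hlt, hlt.not_gt, pairCount_comm n k l]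

theorem transpose_laplacian (n : Edge K → ℕ) : (laplacian n)ᵀ = laplacian n := by
  rw [laplacian_eq, transpose_mul, transpose_transpose]

theorem transpose_residMatrix (n : Edge K → ℕ) : (residMatrix n)ᵀ = residMatrix n := by
  simp [residMatrix, transpose_pinv_of_isSymm (transpose_laplacian n), Matrix.mul_assoc]

theorem residMatrix_mul_self (n : Edge K → ℕ) : residMatrix n * residMatrix n = residMatrix n := by
  set V := (linMatrix K)ᵀ * (obsMatrix n)ᵀ with hV
  have hR : residMatrix n = 1 - Vᵀ * pinv (laplacian n) * V := by
    rw [residMatrix, hV, transpose_mul, transpose_transpose, transpose_transpose]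
    simp only [Matrix.mul_assoc]
  have h : Vᵀ * pinv (laplacian n) * V * (Vᵀ * pinv (laplacian n) * V) =
      Vᵀ * pinv (laplacian n) * V := by
    calc _ = Vᵀ * (pinv (laplacian n) * (V * Vᵀ) * pinv (laplacian n)) * V := by
          simp only [Matrix.mul_assoc]
      _ = _ := by
          rw [hV, ← laplacian_eq, (isMoorePenrose_pinv (laplacian n)).mul_mul_inv]
  rw [hR, Matrix.mul_sub, Matrix.sub_mul, Matrix.sub_mul, h]
  simp

variable (s : Finset (Triad K)) (n : Edge K → ℕ) (y : Obs n → ℝ)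

/-- The residuals of the explicit estimator are orthogonal to the columns of `L B`. -/
theorem transpose_linMatrix_resid :
    ((linMatrix K)ᵀ * (obsMatrix n)ᵀ) *ᵥ (y - obsMatrix n *ᵥ
      (linMatrix K *ᵥ muHat s n y + cycSubMatrix s *ᵥ gammaHat s n y)) = 0 := by
  set V := (linMatrix K)ᵀ * (obsMatrix n)ᵀ with hV
  have hVt : obsMatrix n * linMatrix K = Vᵀ := by
    rw [hV, transpose_mul, transpose_transpose, transpose_transpose]
  rw [mulVec_add, mulVec_mulVec, mulVec_mulVec, hVt, ← sub_sub, sub_right_comm, mulVec_sub V,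
    muHat, Matrix.mul_assoc (pinv _), ← hV]
  simp only [mulVec_mulVec]
  rw [← Matrix.mul_assoc, ← Matrix.mul_assoc, hV, laplacian_eq, mul_transpose_mul_pinv_mul,
    sub_self]

/-- The residuals of the explicit estimator are orthogonal to the columns of `L C_s`. -/
theorem transpose_cycSubMatrix_resid :
    ((cycSubMatrix s)ᵀ * (obsMatrix n)ᵀ) *ᵥ (y - obsMatrix n *ᵥ
      (linMatrix K *ᵥ muHat s n y + cycSubMatrix s *ᵥ gammaHat s n y)) = 0 := by
  set V := (cycSubMatrix s)ᵀ * (obsMatrix n)ᵀ * residMatrix n with hV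
  have hres : y - obsMatrix n *ᵥ
      (linMatrix K *ᵥ muHat s n y + cycSubMatrix s *ᵥ gammaHat s n y) =
      residMatrix n *ᵥ (y - (obsMatrix n * cycSubMatrix s) *ᵥ gammaHat s n y) := by
    rw [residMatrix, sub_mulVec, one_mulVec, muHat, mulVec_add]
    simp only [mulVec_mulVec, Matrix.mul_assoc]
    abel
  have hVV : (cycSubMatrix s)ᵀ * (obsMatrix n)ᵀ * residMatrix n * obsMatrix n * cycSubMatrix s
      = V * Vᵀ := by
    have hVt : Vᵀ = residMatrix n * obsMatrix n * cycSubMatrix s := by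
      rw [hV, transpose_mul, transpose_mul, transpose_transpose, transpose_transpose,
        transpose_residMatrix, Matrix.mul_assoc]
    rw [hVt, hV]
    calc _ = (cycSubMatrix s)ᵀ * (obsMatrix n)ᵀ * (residMatrix n * residMatrix n) *
          obsMatrix n * cycSubMatrix s := by rw [residMatrix_mul_self]
      _ = _ := by simp only [Matrix.mul_assoc]
  have hVC : V * (obsMatrix n * cycSubMatrix s) = V * Vᵀ := by
    rw [← hVV, hV]
    simp only [Matrix.mul_assoc]
  rw [hres, mulVec_mulVec, ← hV, mulVec_sub, mulVec_mulVec, hVC, gammaHat, ← hV, hVV,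
    mulVec_mulVec, ← Matrix.mul_assoc, mul_transpose_mul_pinv_mul, sub_self]

theorem sum_muHat : ∑ i, muHat s n y i = 0 := by
  have h1 : laplacian n *ᵥ (1 : Fin K → ℝ) = 0 := by
    rw [laplacian_eq, transpose_mul, transpose_transpose, transpose_transpose]
    have : linMatrix K *ᵥ (1 : Fin K → ℝ) = 0 := by ext e; simp [linMatrix_mulVec]
    simp only [← mulVec_mulVec, this, mulVec_zero]
  have h2 : ∑ i, muHat s n y i = 1 ⬝ᵥ muHat s n y := by simp [dotProduct]
  rw [h2, muHat, Matrix.mul_assoc, ← mulVec_mulVec, dotProduct_mulVec,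
    vecMul_pinv_eq_zero (transpose_laplacian n) h1, zero_dotProduct]

/-- The normal equations for the explicit estimator, for an arbitrary design. -/
theorem transpose_designMatrix_resid :
    (designMatrix s)ᵀ *ᵥ ((obsMatrix n)ᵀ *ᵥ (y - obsMatrix n *ᵥ
      (designMatrix s *ᵥ Sum.elim (muHat s n y) (gammaHat s n y)))) = 0 := by
  rw [designMatrix_mulVec_elim, designMatrix, transpose_fromCols, fromRows_mulVec, mulVec_mulVec,
    mulVec_mulVec, transpose_linMatrix_resid, transpose_cycSubMatrix_resid]
  ext (i | i) <;> rfl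

variable {s} {n}

theorem elim_muHat_gammaHat (hinj : ∀ δ : s → ℝ, cycSubMatrix s *ᵥ δ = 0 → δ = 0)
    (hn : ∀ e, 0 < n e) :
    Sum.elim (muHat s n y) (gammaHat s n y) =
      solMatrix s (fun e => (n e : ℝ)) *ᵥ ((obsMatrix n)ᵀ *ᵥ y) := by
  rw [eq_solMatrix_mulVec_iff hinj fun e => Nat.cast_pos.2 (hn e), shiftVec_dotProduct_elim,
    sum_muHat, gramMatrix_mulVec, ← transpose_obsMatrix_mulVec_obsMatrix]
  have := transpose_designMatrix_resid s n y
  rw [mulVec_sub, mulVec_sub, sub_eq_zero] at this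
  exact ⟨this.symm, rfl⟩

theorem sumSq_eq (μ : Fin K → ℝ) (γs : s → ℝ) :
    sumSq s n y μ γs = (y - obsMatrix n *ᵥ (designMatrix s *ᵥ Sum.elim μ γs)) ⬝ᵥ
      (y - obsMatrix n *ᵥ (designMatrix s *ᵥ Sum.elim μ γs)) := by
  rw [designMatrix_mulVec_elim, sumSq]
  exact Finset.sum_congr rfl fun o _ => sq _

/-- Pythagoras: moving away from the explicit estimator increases the sum of squares by the
squared length of the change of the fitted values. -/
theorem sumSq_eq_add (μ : Fin K → ℝ) (γs : s → ℝ) :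
    sumSq s n y μ γs = sumSq s n y (muHat s n y) (gammaHat s n y) +
      ∑ e, (n e : ℝ) * (designMatrix s *ᵥ
        (Sum.elim μ γs - Sum.elim (muHat s n y) (gammaHat s n y))) e ^ 2 := by
  set β := Sum.elim (muHat s n y) (gammaHat s n y) with hβ
  set δ := Sum.elim μ γs - β with hδ
  set r := y - obsMatrix n *ᵥ (designMatrix s *ᵥ β) with hr
  set d := obsMatrix n *ᵥ (designMatrix s *ᵥ δ) with hd
  have h1 : y - obsMatrix n *ᵥ (designMatrix s *ᵥ Sum.elim μ γs) = r - d := by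
    rw [hr, hd, hδ, mulVec_sub, mulVec_sub]
    abel
  have h2 : r ⬝ᵥ d = 0 := by
    have h := transpose_designMatrix_resid s n y
    rw [← hβ, ← hr] at h
    rw [hd, dotProduct_mulVec, dotProduct_mulVec, ← mulVec_transpose, ← mulVec_transpose, h,
      zero_dotProduct]
  have h3 : d ⬝ᵥ d = ∑ e, (n e : ℝ) * (designMatrix s *ᵥ δ) e ^ 2 := by
    rw [dotProduct, Fintype.sum_sigma]
    refine Finset.sum_congr rfl fun e _ => ?_
    simp only [hd, obsMatrix_mulVec, sq]
    simp
  rw [sumSq_eq, sumSq_eq, h1, ← hβ, ← hr, ← h3, sub_dotProduct r, dotProduct_sub r r,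
    dotProduct_sub d, dotProduct_comm d r, h2]
  ring

theorem isLSE_iff (hinj : ∀ δ : s → ℝ, cycSubMatrix s *ᵥ δ = 0 → δ = 0) (hn : ∀ e, 0 < n e)
    (μ : Fin K → ℝ) (γs : s → ℝ) :
    IsLSE s n y μ γs ↔ μ = muHat s n y ∧ γs = gammaHat s n y := by
  have hnn : ∀ (μ : Fin K → ℝ) (γs : s → ℝ), ∀ e ∈ Finset.univ, 0 ≤ (n e : ℝ) * (designMatrix s *ᵥ
      (Sum.elim μ γs - Sum.elim (muHat s n y) (gammaHat s n y))) e ^ 2 :=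
    fun μ γs e _ => by positivity
  constructor
  · rintro ⟨hsum, hmin⟩
    have h := hmin _ (gammaHat s n y) (sum_muHat s n y)
    rw [sumSq_eq_add y μ γs, add_le_iff_nonpos_right] at h
    have h0 := (Finset.sum_eq_zero_iff_of_nonneg (hnn μ γs)).1
      (h.antisymm (Finset.sum_nonneg (hnn μ γs)))
    have hX : designMatrix s *ᵥ
        (Sum.elim μ γs - Sum.elim (muHat s n y) (gammaHat s n y)) = 0 := by
      ext e
      simpa [(hn e).ne'] using h0 e (Finset.mem_univ e)
    have hβ := eq_zero_of_designMatrix_mulVec hinj hX (by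
      rw [dotProduct_sub, shiftVec_dotProduct_elim, shiftVec_dotProduct_elim, hsum, sum_muHat,
        sub_zero])
    rw [sub_eq_zero] at hβ
    exact ⟨congrArg (· ∘ Sum.inl) hβ, congrArg (· ∘ Sum.inr) hβ⟩
  · rintro ⟨rfl, rfl⟩
    refine ⟨sum_muHat s n y, fun μ γs _ => ?_⟩
    rw [sumSq_eq_add y μ γs]
    exact le_add_of_nonneg_right (Finset.sum_nonneg (hnn μ γs))

theorem continuous_estimator : Continuous (estimator s n) := by
  have h1 : Continuous (gammaHat s n) := by unfold gammaHat; fun_prop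
  have h2 : Continuous (muHat s n) := by unfold muHat; fun_prop
  refine (PiLp.continuous_toLp 2 _).comp (continuous_pi ?_)
  rintro (i | t)
  · exact (continuous_apply i).comp h2
  · exact (continuous_apply t).comp h1

/-- The estimation error is a linear image of the sums of the errors over each pair. -/
theorem elim_muHat_gammaHat_response {Ω : Type*}
    (hinj : ∀ δ : s → ℝ, cycSubMatrix s *ᵥ δ = 0 → δ = 0)
    (hn : ∀ e, 0 < n e) {ν : Edge K → ℝ} {μ : Fin K → ℝ} {γs : s → ℝ} (hμ : ∑ i, μ i = 0)
    (hν : ν = linMatrix K *ᵥ μ + cycSubMatrix s *ᵥ γs) (ε : Obs n → Ω → ℝ) (ω : Ω) :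
    Sum.elim (muHat s n (response ν n ε ω)) (gammaHat s n (response ν n ε ω)) =
      Sum.elim μ γs + solMatrix s (fun e => (n e : ℝ)) *ᵥ fun e => ∑ k, ε ⟨e, k⟩ ω := by
  have h1 : (obsMatrix n)ᵀ *ᵥ response ν n ε ω =
      (fun e => (n e : ℝ)) * designMatrix s *ᵥ Sum.elim μ γs + fun e => ∑ k, ε ⟨e, k⟩ ω := by
    ext e
    rw [transpose_obsMatrix_mulVec, designMatrix_mulVec_elim, ← hν]
    simp [response, Finset.sum_add_distrib]
  rw [elim_muHat_gammaHat _ hinj hn, h1, mulVec_add, solMatrix_mulVec_mul_designMatrix hinj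
    (fun e => Nat.cast_pos.2 (hn e)) (by rw [shiftVec_dotProduct_elim, hμ])]

end Estimator

/-! ### Characteristic functions of sums with small coefficients -/

section CharFun

/-- The compound-interest limit `(1 + gᵢ) ^ kᵢ → exp t`, for exponents `kᵢ` along an arbitrary
filter. -/
theorem tendsto_one_add_pow_exp {ι : Type*} {l : Filter ι} {k : ι → ℕ} {g : ι → ℂ} {t : ℂ}
    (hg : Tendsto g l (𝓝 0)) (hkg : Tendsto (fun i => (k i : ℂ) * g i) l (𝓝 t)) :
    Tendsto (fun i => (1 + g i) ^ k i) l (𝓝 (Complex.exp t)) := by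
  have hlog : (fun z : ℂ => Complex.log (1 + z) - z) =o[𝓝 0] fun z => z := by
    have h1 := hasDerivAt_iff_isLittleO_nhds_zero.1
      (Complex.hasDerivAt_log (z := 1) Complex.one_mem_slitPlane)
    simpa using h1
  have h3 : (fun i => (k i : ℂ) * (Complex.log (1 + g i) - g i)) =o[l]
      fun i => (k i : ℂ) * g i :=
    (Asymptotics.isBigO_refl _ _).mul_isLittleO (hlog.comp_tendsto hg)
  have h4 : Tendsto (fun i => (k i : ℂ) * (Complex.log (1 + g i) - g i)) l (𝓝 0) :=
    (Asymptotics.isLittleO_one_iff ℂ).1 (h3.trans_isBigO (hkg.isBigO_one ℂ))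
  have h5 : Tendsto (fun i => (k i : ℂ) * Complex.log (1 + g i)) l (𝓝 t) := by
    simpa [mul_sub] using h4.add hkg
  refine ((Complex.continuous_exp.tendsto t).comp h5).congr' ?_
  have h6 : Tendsto (fun i => 1 + g i) l (𝓝 1) := by simpa using hg.const_add 1
  filter_upwards [h6.eventually_ne one_ne_zero] with i hi
  rw [Function.comp_apply, Complex.exp_nat_mul, Complex.exp_log hi]

variable {Ω : Type*} [MeasurableSpace Ω] {P : Measure Ω}

/-- The second-order expansion of the characteristic function, raised to the power `k`. -/
theorem tendsto_charFun_pow [IsProbabilityMeasure P] {ξ : Ω → ℝ} {σ : ℝ} (hξ : MemLp ξ 2 P)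
    (h0 : ∫ ω, ξ ω ∂P = 0) (hσ : Var[ξ; P] = σ ^ 2) {k : ℕ → ℕ} {a : ℕ → ℝ} {c : ℝ}
    (ha : Tendsto a atTop (𝓝 0))
    (hka : Tendsto (fun m => (k m : ℝ) * a m ^ 2) atTop (𝓝 c)) :
    Tendsto (fun m => charFun (P.map ξ) (a m) ^ k m) atTop
      (𝓝 (Complex.exp ((-(σ ^ 2 * c / 2) : ℝ) : ℂ))) := by
  have hm := hξ.aestronglyMeasurable.aemeasurable
  have : IsProbabilityMeasure (P.map ξ) := Measure.isProbabilityMeasure_map hm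
  have hid : MemLp id 2 (P.map ξ) :=
    (memLp_map_measure_iff aestronglyMeasurable_id hm).2 hξ
  have hsq : ∫ ω, (ξ ^ 2) ω ∂P = σ ^ 2 := by
    rw [← hσ, variance_of_integral_eq_zero hm h0]
    rfl
  have htaylor : (fun t => charFun (P.map ξ) t - (1 - ((σ ^ 2 : ℝ) : ℂ) * t ^ 2 / 2)) =o[𝓝 0]
      fun t : ℝ => t ^ 2 := by
    have h := taylor_isLittleO_univ (x₀ := 0) (contDiff_charFun (n := 2) hid)
    simp only [taylorWithinEval_charFun_two_zero hm hid, h0, hsq, sub_zero] at h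
    simpa using h
  obtain ⟨r, hr⟩ : ∃ r : ℕ → ℂ, r = fun m =>
    charFun (P.map ξ) (a m) - (1 - ((σ ^ 2 : ℝ) : ℂ) * (a m : ℂ) ^ 2 / 2) := ⟨_, rfl⟩
  have hr1 : r =o[atTop] fun m => a m ^ 2 := by
    rw [hr]
    exact htaylor.comp_tendsto ha
  have hkr : Tendsto (fun m => (k m : ℂ) * r m) atTop (𝓝 0) := by
    have h : (fun m => (k m : ℂ) * r m) =o[atTop] fun m => (k m : ℝ) * a m ^ 2 := by
      refine Asymptotics.IsBigO.mul_isLittleO ?_ hr1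
      exact Asymptotics.isBigO_of_le _ fun m => by simp
    exact (Asymptotics.isLittleO_one_iff ℝ).1 (h.trans_isBigO (hka.isBigO_one ℝ))
  have hrz : Tendsto r atTop (𝓝 0) := by
    have h : Tendsto (fun m => a m ^ 2) atTop (𝓝 0) := by simpa using ha.pow 2
    exact (Asymptotics.isLittleO_one_iff ℝ).1 (hr1.trans_isBigO (h.isBigO_one ℝ))
  have hac : Tendsto (fun m => (a m : ℂ)) atTop (𝓝 0) := by
    simpa [Function.comp_def] using (Complex.continuous_ofReal.tendsto 0).comp ha
  have hkac : Tendsto (fun m => (k m : ℂ) * (a m : ℂ) ^ 2) atTop (𝓝 (c : ℂ)) := by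
    simpa [Function.comp_def] using (Complex.continuous_ofReal.tendsto c).comp hka
  have hg : Tendsto (fun m => r m - ((σ ^ 2 : ℝ) : ℂ) * (a m : ℂ) ^ 2 / 2) atTop (𝓝 0) := by
    have h := hrz.sub (((hac.pow 2).const_mul ((σ ^ 2 : ℝ) : ℂ)).div_const 2)
    rwa [zero_pow two_ne_zero, mul_zero, zero_div, sub_zero] at h
  have hkg : Tendsto (fun m => (k m : ℂ) * (r m - ((σ ^ 2 : ℝ) : ℂ) * (a m : ℂ) ^ 2 / 2)) atTop
      (𝓝 ((-(σ ^ 2 * c / 2) : ℝ) : ℂ)) := by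
    have h := hkr.sub ((hkac.const_mul ((σ ^ 2 : ℝ) : ℂ)).div_const 2)
    convert! h using 2
    · ring
    · push_cast
      ring
  convert! tendsto_one_add_pow_exp hg hkg using 3 with m
  rw [hr]
  ring

/-- The characteristic function at `t` of a random vector whose inner product with `t` is a
linear combination `∑ₒ cₒ ξₒ` of independent variables. -/
theorem charFun_map_eq_prod {ι E : Type*} [Fintype ι] [NormedAddCommGroup E]
    [InnerProductSpace ℝ E] [MeasurableSpace E] [BorelSpace E] [SecondCountableTopology E]
    {ξ : ι → Ω → ℝ} (hind : iIndepFun ξ P) (hm : ∀ o, AEMeasurable (ξ o) P) {V : Ω → E}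
    (hV : AEMeasurable V P) {t : E} {c : ι → ℝ}
    (hc : ∀ ω, inner ℝ (V ω) t = ∑ o, c o * ξ o ω) :
    charFun (P.map V) t = ∏ o, charFun (P.map (ξ o)) (c o) := by
  have h1 : charFun (P.map V) t = charFun (P.map fun ω => ∑ o, c o * ξ o ω) 1 := by
    rw [charFun_apply, charFun_apply, integral_map hV (by fun_prop), integral_map (by fun_prop)
      (by fun_prop)]
    simp [hc]
  have h2 : iIndepFun (fun o ω => c o * ξ o ω) P :=
    hind.comp (fun o x => c o * x) fun o => by fun_prop
  rw [h1, h2.charFun_map_fun_sum_eq_prod fun o => by fun_prop, Finset.prod_apply]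
  refine Finset.prod_congr rfl fun o _ => ?_
  rw [charFun_map_mul_comp (hm o), mul_one]

end CharFun

/-! ### Sums of errors -/

section Errors

variable {Ω : Type*} [MeasurableSpace Ω] {P : Measure Ω} {K : ℕ}

theorem IIDErrors.integrable [IsFiniteMeasure P] {ι : Type*} {ε : ι → Ω → ℝ} {σ : ℝ}
    (h : IIDErrors ε σ P) (a : ι) : Integrable (ε a) P :=
  (h.memLp_two a).integrable one_le_two

theorem IIDErrors.comp_injective {ι κ : Type*} {ε : ι → Ω → ℝ} {σ : ℝ} (h : IIDErrors ε σ P)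
    {f : κ → ι} (hf : Function.Injective f) : IIDErrors (fun a => ε (f a)) σ P where
  indep := h.indep.precomp hf
  identDistrib _ _ := h.identDistrib _ _
  memLp_two _ := h.memLp_two _
  mean_eq_zero _ := h.mean_eq_zero _
  variance_eq _ := h.variance_eq _

theorem IIDErrors.firstErrors {ε : Edge K × ℕ → Ω → ℝ} {σ : ℝ} (h : IIDErrors ε σ P)
    (n : Edge K → ℕ) : IIDErrors (firstErrors ε n) σ P := by
  refine h.comp_injective (f := fun o : Obs n => (o.1, (o.2 : ℕ))) ?_
  rintro ⟨e, k⟩ ⟨e', k'⟩ hek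
  simp only [Prod.mk.injEq] at hek
  obtain ⟨rfl, hk⟩ := hek
  rw [Fin.ext hk]

theorem IIDErrors.memLp_sum {ι : Type*} [Fintype ι] {ε : ι → Ω → ℝ} {σ : ℝ}
    (h : IIDErrors ε σ P) : MemLp (fun ω => ∑ a, ε a ω) 2 P :=
  memLp_finsetSum _ fun a _ => h.memLp_two a

variable [IsProbabilityMeasure P]

theorem IIDErrors.integral_sum_sq {ι : Type*} [Fintype ι] {ε : ι → Ω → ℝ} {σ : ℝ}
    (h : IIDErrors ε σ P) : ∫ ω, (∑ a, ε a ω) ^ 2 ∂P = Fintype.card ι * σ ^ 2 := by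
  have h0 : ∫ ω, (∑ a, ε a) ω ∂P = 0 := by
    simp only [Finset.sum_apply]
    rw [integral_finsetSum _ fun a _ => h.integrable a]
    simp [h.mean_eq_zero]
  have hm : AEMeasurable (∑ a, ε a) P := Finset.aemeasurable_sum _ fun a _ =>
    (h.memLp_two a).aestronglyMeasurable.aemeasurable
  have h1 := variance_of_integral_eq_zero hm h0
  rw [IndepFun.variance_sum (fun a _ => h.memLp_two a)
    (fun a _ b _ hab => h.indep.indepFun hab)] at h1
  simpa [h.variance_eq] using h1.symm

end Errors

/-! ### Unbiasedness, consistency and asymptotic normality -/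

section Asymptotics

variable {K : ℕ} {s : Finset (Triad K)} {σ : ℝ} {ν : Edge K → ℝ} {μ : Fin K → ℝ} {γs : s → ℝ}

theorem estimator_sub_coefVec {Ω : Type*}
    (hinj : ∀ δ : s → ℝ, cycSubMatrix s *ᵥ δ = 0 → δ = 0)
    (hμ : ∑ i, μ i = 0) (hν : ν = linMatrix K *ᵥ μ + cycSubMatrix s *ᵥ γs)
    {n : Edge K → ℕ} (hn : ∀ e, 0 < n e) (ε : Obs n → Ω → ℝ) (ω : Ω) :
    estimator s n (response ν n ε ω) - coefVec μ γs =
      WithLp.toLp 2 (solMatrix s (fun e => (n e : ℝ)) *ᵥ fun e => ∑ k, ε ⟨e, k⟩ ω) := by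
  rw [estimator, coefVec, coefVec, elim_muHat_gammaHat_response hinj hn hμ hν, ← WithLp.toLp_sub,
    add_sub_cancel_left]

theorem aemeasurable_estimator_response {Ω : Type*} [MeasurableSpace Ω] {P : Measure Ω}
    {n : Edge K → ℕ} {ε : Obs n → Ω → ℝ}
    (hε : ∀ o, AEMeasurable (ε o) P) :
    AEMeasurable (fun ω => estimator s n (response ν n ε ω)) P :=
  continuous_estimator.measurable.comp_aemeasurable
    (aemeasurable_pi_lambda _ fun o => (hε o).const_add (ν o.1))

/-- The size of the estimation error in terms of the noise `z`, uniformly in the weights. -/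
theorem exists_norm_solMatrix_sq_le (hinj : ∀ δ : s → ℝ, cycSubMatrix s *ᵥ δ = 0 → δ = 0) :
    ∃ C : ℝ, 0 ≤ C ∧ ∀ w : Edge K → ℝ, (∀ e, 0 < w e) → ∀ z : Edge K → ℝ,
      ‖(WithLp.toLp 2 (solMatrix s w *ᵥ z) : EuclideanSpace ℝ (Fin K ⊕ s))‖ ^ 2 ≤
        C * (∑ e, (w e)⁻¹) * ∑ e, z e ^ 2 / w e := by
  refine ⟨∑ i, ∑ e, solMatrix s 1 i e ^ 2, by positivity, fun w hw z => ?_⟩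
  set δ := solMatrix s w *ᵥ z with hδ
  set x := designMatrix s *ᵥ δ with hx
  -- `δ` is recovered from its fitted values `x` by the unweighted solution matrix
  have h1 : δ = solMatrix s 1 *ᵥ x := by
    have h := solMatrix_mulVec_mul_designMatrix hinj (w := 1) (fun _ => one_pos)
      ((eq_solMatrix_mulVec_iff hinj hw).1 hδ).2
    rw [one_mul] at h
    exact h.symm
  have h2 : ‖(WithLp.toLp 2 δ : EuclideanSpace ℝ (Fin K ⊕ s))‖ ^ 2 ≤
      (∑ i, ∑ e, solMatrix s 1 i e ^ 2) * ∑ e, x e ^ 2 := by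
    rw [EuclideanSpace.real_norm_sq_eq, Finset.sum_mul]
    refine Finset.sum_le_sum fun i _ => ?_
    rw [h1]
    exact Finset.sum_mul_sq_le_sq_mul_sq _ _ _
  have h3 : ∀ e, x e ^ 2 ≤ (w e)⁻¹ * ∑ e, z e ^ 2 / w e := fun e => by
    have h4 : w e * x e ^ 2 ≤ ∑ e, z e ^ 2 / w e :=
      (Finset.single_le_sum (f := fun e => w e * x e ^ 2)
        (fun e _ => mul_nonneg (hw e).le (sq_nonneg _)) (Finset.mem_univ e)).trans
        (sum_mul_designMatrix_solMatrix_sq_le hinj hw z)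
    rwa [le_inv_mul_iff₀ (hw e)]
  refine h2.trans ?_
  rw [mul_assoc]
  refine mul_le_mul_of_nonneg_left ?_ (by positivity)
  rw [Finset.sum_mul]
  exact Finset.sum_le_sum fun e _ => h3 e

theorem asympCov_eq (hinj : ∀ δ : s → ℝ, cycSubMatrix s *ᵥ δ = 0 → δ = 0) {θ : Edge K → ℝ}
    (hθ : ∀ e, 0 < θ e) :
    asympCov s θ σ = σ ^ 2 • (solMatrix s θ * diagonal θ * (solMatrix s θ)ᵀ) := by
  rw [← pinv_gramMatrix_mul_transpose hinj hθ, transpose_mul,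
    transpose_pinv_of_isSymm (transpose_gramMatrix θ), transpose_transpose, asympCov, designMatrix]
  simp only [Matrix.mul_assoc]

theorem posSemidef_asympCov (hinj : ∀ δ : s → ℝ, cycSubMatrix s *ᵥ δ = 0 → δ = 0)
    {θ : Edge K → ℝ} (hθ : ∀ e, 0 < θ e) : (asympCov s θ σ).PosSemidef := by
  rw [asympCov_eq hinj hθ]
  refine PosSemidef.smul ?_ (sq_nonneg σ)
  have h := (PosSemidef.diagonal fun e => (hθ e).le).mul_mul_conjTranspose_same (solMatrix s θ)
  rwa [conjTranspose_eq_transpose_of_trivial] at h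

theorem dotProduct_asympCov_mulVec (hinj : ∀ δ : s → ℝ, cycSubMatrix s *ᵥ δ = 0 → δ = 0)
    {θ : Edge K → ℝ} (hθ : ∀ e, 0 < θ e) (t : Fin K ⊕ s → ℝ) :
    t ⬝ᵥ asympCov s θ σ *ᵥ t = ∑ e, σ ^ 2 * (θ e * (t ᵥ* solMatrix s θ) e ^ 2) := by
  rw [asympCov_eq hinj hθ, smul_mulVec, dotProduct_smul, ← mulVec_mulVec, ← mulVec_mulVec,
    dotProduct_mulVec, mulVec_transpose, smul_eq_mul, ← Finset.mul_sum]
  congr 1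
  exact Finset.sum_congr rfl fun e _ => by rw [mulVec_diagonal]; ring

variable {Ω : Type*} [MeasurableSpace Ω] {P : Measure Ω} [IsProbabilityMeasure P]

theorem integrable_and_integral_elim_response
    (hinj : ∀ δ : s → ℝ, cycSubMatrix s *ᵥ δ = 0 → δ = 0)
    (hμ : ∑ i, μ i = 0) (hν : ν = linMatrix K *ᵥ μ + cycSubMatrix s *ᵥ γs)
    {n : Edge K → ℕ} (hn : ∀ e, 0 < n e) {ε : Obs n → Ω → ℝ} (hε : IIDErrors ε σ P)
    (i : Fin K ⊕ s) :
    Integrable (fun ω => Sum.elim (muHat s n (response ν n ε ω))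
        (gammaHat s n (response ν n ε ω)) i) P ∧
      ∫ ω, Sum.elim (muHat s n (response ν n ε ω)) (gammaHat s n (response ν n ε ω)) i ∂P =
        Sum.elim μ γs i := by
  simp only [elim_muHat_gammaHat_response hinj hn hμ hν, Pi.add_apply, mulVec, dotProduct]
  have h1 : ∀ e, Integrable (fun ω => ∑ k, ε ⟨e, k⟩ ω) P := fun e =>
    integrable_finsetSum _ fun k _ => hε.integrable _
  have h2 : Integrable (fun ω => ∑ e, solMatrix s (fun e => (n e : ℝ)) i e * ∑ k, ε ⟨e, k⟩ ω) P :=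
    integrable_finsetSum _ fun e _ => (h1 e).const_mul _
  refine ⟨(integrable_const _).add h2, ?_⟩
  rw [integral_add (integrable_const _) h2, integral_finsetSum _ fun e _ => (h1 e).const_mul _]
  simp only [integral_const_mul]
  simp [integral_finsetSum _ fun k _ => hε.integrable _, hε.mean_eq_zero]

/-- Consistency: Markov's inequality applied to the bound of the squared error. -/
theorem tendstoInMeasure_estimator (hinj : ∀ δ : s → ℝ, cycSubMatrix s *ᵥ δ = 0 → δ = 0)
    (hμ : ∑ i, μ i = 0) (hν : ν = linMatrix K *ᵥ μ + cycSubMatrix s *ᵥ γs)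
    {ε : Edge K × ℕ → Ω → ℝ} (hε : IIDErrors ε σ P) {n : ℕ → Edge K → ℕ}
    (hn : ∀ e, Tendsto (fun m => n m e) atTop atTop) :
    TendstoInMeasure P
      (fun m ω => estimator s (n m) (response ν (n m) (firstErrors ε (n m)) ω)) atTop
      (fun _ => coefVec μ γs) := by
  rw [tendstoInMeasure_iff_measureReal_norm]
  intro r hr
  obtain ⟨C, hC, hbound⟩ := exists_norm_solMatrix_sq_le hinj
  have hR : Tendsto (fun m => ∑ e, ((n m e : ℝ))⁻¹) atTop (𝓝 0) := by
    have h : Tendsto (fun m => ∑ e, ((n m e : ℝ))⁻¹) atTop (𝓝 (∑ _e : Edge K, 0)) :=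
      tendsto_finsetSum _ fun e _ =>
      tendsto_inv_atTop_zero.comp (tendsto_natCast_atTop_atTop.comp (hn e))
    simpa using h
  have hlim : Tendsto (fun m => C * (∑ e, ((n m e : ℝ))⁻¹) *
      (Fintype.card (Edge K) * σ ^ 2) / r ^ 2) atTop (𝓝 0) := by
    simpa using ((hR.const_mul C).mul_const (Fintype.card (Edge K) * σ ^ 2)).div_const (r ^ 2)
  refine squeeze_zero' (Eventually.of_forall fun m => measureReal_nonneg) ?_ hlim
  have hpos : ∀ᶠ m in atTop, ∀ e, 0 < n m e :=
    eventually_all.2 fun e => (hn e).eventually_gt_atTop 0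
  filter_upwards [hpos] with m hm
  have hmε := hε.firstErrors (n m)
  set R := ∑ e, ((n m e : ℝ))⁻¹
  set Q : Ω → ℝ := fun ω =>
    C * R * ∑ e, (∑ k, firstErrors ε (n m) ⟨e, k⟩ ω) ^ 2 / (n m e : ℝ) with hQ
  have hsum : ∀ e, IIDErrors (fun k => firstErrors ε (n m) ⟨e, k⟩) σ P := fun e =>
    hmε.comp_injective (f := fun k => (⟨e, k⟩ : Obs (n m))) fun k k' hk => by simpa using hk
  have hint : ∀ e, Integrable (fun ω => (∑ k, firstErrors ε (n m) ⟨e, k⟩ ω) ^ 2 / (n m e : ℝ)) P :=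
    fun e => ((hsum e).memLp_sum.integrable_sq).div_const _
  have hQint : Integrable Q P := (integrable_finsetSum _ fun e _ => hint e).const_mul _
  have hQval : ∫ ω, Q ω ∂P = C * R * (Fintype.card (Edge K) * σ ^ 2) := by
    rw [hQ, integral_const_mul, integral_finsetSum _ fun e _ => hint e]
    congr 1
    have : ∀ e, ∫ ω, (∑ k, firstErrors ε (n m) ⟨e, k⟩ ω) ^ 2 / (n m e : ℝ) ∂P = σ ^ 2 := by
      intro e
      rw [integral_div, (hsum e).integral_sum_sq, Fintype.card_fin]
      have : (n m e : ℝ) ≠ 0 := by exact_mod_cast (hm e).ne'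
      field_simp
    simp [this]
  have hQnn : 0 ≤ᵐ[P] Q := Eventually.of_forall fun ω => by
    simp only [Pi.zero_apply, hQ]
    positivity
  have hmarkov := mul_meas_ge_le_integral_of_nonneg hQnn hQint (r ^ 2)
  rw [hQval] at hmarkov
  rw [le_div_iff₀ (by positivity), mul_comm]
  refine le_trans (mul_le_mul_of_nonneg_left (measureReal_mono ?_) (by positivity)) hmarkov
  intro ω hω
  simp only [Set.mem_ofPred_eq] at hω ⊢
  rw [estimator_sub_coefVec hinj hμ hν hm] at hω
  exact (pow_le_pow_left₀ hr.le hω 2).trans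
    (hbound _ (fun e => Nat.cast_pos.2 (hm e)) _)

/-- Asymptotic normality, by convergence of the characteristic functions. -/
theorem tendstoInDistribution_estimator (hinj : ∀ δ : s → ℝ, cycSubMatrix s *ᵥ δ = 0 → δ = 0)
    (hμ : ∑ i, μ i = 0) (hν : ν = linMatrix K *ᵥ μ + cycSubMatrix s *ᵥ γs)
    {ε : Edge K × ℕ → Ω → ℝ} (hε : IIDErrors ε σ P) {n : ℕ → Edge K → ℕ}
    (hn : ∀ e, Tendsto (fun m => n m e) atTop atTop) {θ : Edge K → ℝ} (hθ : ∀ e, 0 < θ e)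
    (hnθ : ∀ e, Tendsto (fun m => (n m e : ℝ) / (totalCount (n m) : ℝ)) atTop (𝓝 (θ e))) :
    TendstoInDistribution
      (fun m ω => Real.sqrt (totalCount (n m) : ℝ) •
        (estimator s (n m) (response ν (n m) (firstErrors ε (n m)) ω) - coefVec μ γs))
      atTop (id : EuclideanSpace ℝ (Fin K ⊕ s) → EuclideanSpace ℝ (Fin K ⊕ s)) (fun _ => P)
      (multivariateGaussian 0 (asympCov s θ σ)) := by
  have hεm : ∀ a, AEMeasurable (ε a) P := fun a =>
    (hε.memLp_two a).aestronglyMeasurable.aemeasurable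
  have hmeas : ∀ m, AEMeasurable (fun ω => Real.sqrt (totalCount (n m) : ℝ) •
      (estimator s (n m) (response ν (n m) (firstErrors ε (n m)) ω) - coefVec μ γs)) P :=
    fun m => ((aemeasurable_estimator_response (n := n m) (ε := firstErrors ε (n m))
      fun o => hεm _).sub_const (coefVec μ γs)).const_smul (Real.sqrt (totalCount (n m) : ℝ))
  refine ⟨hmeas, aemeasurable_id, ?_⟩
  refine ProbabilityMeasure.tendsto_iff_tendsto_charFun.2 fun t => ?_
  simp only [ProbabilityMeasure.coe_mk, Measure.map_id]
  rw [charFun_multivariateGaussian (posSemidef_asympCov hinj hθ)]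
  -- the coefficient of each error of the pair `e` in the inner product with `t`
  set c : ℕ → Edge K → ℝ := fun m e => Real.sqrt (totalCount (n m) : ℝ) *
    (t.ofLp ᵥ* solMatrix s (fun e => (n m e : ℝ))) e with hc
  have hpos : ∀ᶠ m in atTop, ∀ e, 0 < n m e :=
    eventually_all.2 fun e => (hn e).eventually_gt_atTop 0
  have hchar : ∀ᶠ m in atTop, ∏ e, charFun (P.map (ε (e, 0))) (c m e) ^ n m e =
      charFun (P.map fun ω => Real.sqrt (totalCount (n m) : ℝ) •
        (estimator s (n m) (response ν (n m) (firstErrors ε (n m)) ω) - coefVec μ γs)) t := by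
    filter_upwards [hpos] with m hm
    have hmε := hε.firstErrors (n m)
    rw [charFun_map_eq_prod (c := fun o : Obs (n m) => c m o.1) hmε.indep
      (fun o => hεm _) (hmeas m), Fintype.prod_sigma]
    · refine Finset.prod_congr rfl fun e _ => ?_
      have : ∀ k : Fin (n m e), P.map (firstErrors ε (n m) ⟨e, k⟩) = P.map (ε (e, 0)) :=
        fun k => (hε.identDistrib _ _).map_eq
      simp [this]
    · intro ω
      rw [estimator_sub_coefVec hinj hμ hν hm, real_inner_smul_left,
        EuclideanSpace.inner_eq_star_dotProduct, star_trivial, dotProduct_mulVec,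
        Fintype.sum_sigma, dotProduct, Finset.mul_sum]
      refine Finset.sum_congr rfl fun e _ => ?_
      rw [hc, ← mul_assoc, Finset.mul_sum]
  refine Tendsto.congr' hchar ?_
  have hlim : Complex.exp (inner ℝ t (0 : EuclideanSpace ℝ (Fin K ⊕ s)) * Complex.I -
      ((t.ofLp ⬝ᵥ asympCov s θ σ *ᵥ t.ofLp : ℝ) : ℂ) / 2) =
      ∏ e, Complex.exp
        ((-(σ ^ 2 * (θ e * (t.ofLp ᵥ* solMatrix s θ) e ^ 2) / 2) : ℝ) : ℂ) := by
    rw [← Complex.exp_sum, dotProduct_asympCov_mulVec hinj hθ, inner_zero_right,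
      ← Complex.ofReal_sum, Finset.sum_neg_distrib, ← Finset.sum_div]
    congr 1
    push_cast
    ring
  rw [hlim]
  refine tendsto_finsetProd _ fun e _ => ?_
  -- with no pair at all the total count is zero, hence its positivity is derived from `e`
  have htot : ∀ᶠ m in atTop, 0 < (totalCount (n m) : ℝ) := by
    filter_upwards [hpos] with m hm
    have : n m e ≤ totalCount (n m) :=
      Finset.single_le_sum (f := n m) (fun _ _ => Nat.zero_le _) (Finset.mem_univ e)
    exact_mod_cast (hm e).trans_le this
  have hsol : Tendsto (fun m => (t.ofLp ᵥ* solMatrix s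
      (fun e => (n m e : ℝ) / (totalCount (n m) : ℝ))) e) atTop
      (𝓝 ((t.ofLp ᵥ* solMatrix s θ) e)) := by
    have h1 := (continuousAt_solMatrix hinj hθ).tendsto.comp (tendsto_pi_nhds.2 hnθ)
    have h2 : Continuous fun M : Matrix (Fin K ⊕ s) (Edge K) ℝ => (t.ofLp ᵥ* M) e := by fun_prop
    exact (h2.tendsto _).comp h1
  have hnc : Tendsto (fun m => (n m e : ℝ) * c m e ^ 2) atTop
      (𝓝 (θ e * (t.ofLp ᵥ* solMatrix s θ) e ^ 2)) := by
    refine ((hnθ e).mul (hsol.pow 2)).congr' ?_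
    filter_upwards [hpos, htot] with m hm hT
    have h1 : (fun e => (n m e : ℝ) / (totalCount (n m) : ℝ)) =
        (totalCount (n m) : ℝ)⁻¹ • fun e => (n m e : ℝ) := by
      ext e
      simp only [Pi.smul_apply, smul_eq_mul]
      ring
    rw [h1, solMatrix_smul hinj (fun e => Nat.cast_pos.2 (hm e)) (inv_pos.2 hT), inv_inv,
      vecMul_smul, Pi.smul_apply, smul_eq_mul, hc, mul_pow, mul_pow, Real.sq_sqrt hT.le]
    field_simp
  have hc0 : Tendsto (fun m => c m e) atTop (𝓝 0) := by
    have h1 : Tendsto (fun m => c m e ^ 2) atTop (𝓝 0) := by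
      have h2 := hnc.mul (tendsto_inv_atTop_zero.comp (tendsto_natCast_atTop_atTop.comp (hn e)))
      rw [mul_zero] at h2
      refine h2.congr' ?_
      filter_upwards [hpos] with m hm
      have : (n m e : ℝ) ≠ 0 := by exact_mod_cast (hm e).ne'
      simp only [Function.comp_apply]
      field_simp
    have h3 := (Real.continuous_sqrt.tendsto 0).comp h1
    rw [tendsto_zero_iff_abs_tendsto_zero]
    simpa [Function.comp_def, Real.sqrt_sq_eq_abs] using h3
  exact tendsto_charFun_pow (hε.memLp_two _) (hε.mean_eq_zero _) (hε.variance_eq _) hc0 hnc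

end Asymptotics

end PairedComparison

theorem mainTheorem4 {Ω : Type*} [MeasurableSpace Ω] (P : Measure Ω) [IsProbabilityMeasure P]
    (K : ℕ) (μ : Fin K → ℝ) (hμ : ∑ i, μ i = 0)
    (ν νcyc : PairedComparison.Edge K → ℝ) (γ : PairedComparison.Triad K → ℝ)
    (hν : ν = PairedComparison.linMatrix K *ᵥ μ + νcyc)
    (hγ : PairedComparison.IsMinimalModel νcyc γ)
    (s : Finset (PairedComparison.Triad K)) (hs : s = PairedComparison.triadsOf γ)
    (σ : ℝ) :
    -- the explicit formulas give the unique least squares estimate, and it is unbiased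
    (∀ n : PairedComparison.Edge K → ℕ, (∀ e, 0 < n e) →
      (∀ (y : PairedComparison.Obs n → ℝ) (μ' : Fin K → ℝ) (γs' : s → ℝ),
        PairedComparison.IsLSE s n y μ' γs' ↔
          μ' = PairedComparison.muHat s n y ∧ γs' = PairedComparison.gammaHat s n y) ∧
      ∀ ε : PairedComparison.Obs n → Ω → ℝ, PairedComparison.IIDErrors ε σ P →
        (∀ i, Integrable (fun ω => PairedComparison.muHat s n
              (PairedComparison.response ν n ε ω) i) P ∧
          ∫ ω, PairedComparison.muHat s n (PairedComparison.response ν n ε ω) i ∂P = μ i) ∧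
        (∀ t, Integrable (fun ω => PairedComparison.gammaHat s n
              (PairedComparison.response ν n ε ω) t) P ∧
          ∫ ω, PairedComparison.gammaHat s n (PairedComparison.response ν n ε ω) t ∂P =
            γ t.1)) ∧
    -- consistency
    (∀ ε : PairedComparison.Edge K × ℕ → Ω → ℝ, PairedComparison.IIDErrors ε σ P →
      ∀ n : ℕ → PairedComparison.Edge K → ℕ, (∀ e, Tendsto (fun m => n m e) atTop atTop) →
        TendstoInMeasure P
          (fun m ω => PairedComparison.estimator s (n m)
            (PairedComparison.response ν (n m) (PairedComparison.firstErrors ε (n m)) ω))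
          atTop
          (fun _ => PairedComparison.coefVec μ (fun t : s => γ t.1))) ∧
    -- asymptotic normality
    (∀ ε : PairedComparison.Edge K × ℕ → Ω → ℝ, PairedComparison.IIDErrors ε σ P →
      ∀ n : ℕ → PairedComparison.Edge K → ℕ, (∀ e, Tendsto (fun m => n m e) atTop atTop) →
      ∀ θ : PairedComparison.Edge K → ℝ, (∀ e, 0 < θ e) →
        (∀ e, Tendsto (fun m => (n m e : ℝ) / (PairedComparison.totalCount (n m) : ℝ)) atTop
          (𝓝 (θ e))) →
        TendstoInDistribution
          (fun m ω => Real.sqrt (PairedComparison.totalCount (n m) : ℝ) •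
            (PairedComparison.estimator s (n m)
                (PairedComparison.response ν (n m) (PairedComparison.firstErrors ε (n m)) ω) -
              PairedComparison.coefVec μ (fun t : s => γ t.1)))
          atTop
          (id : EuclideanSpace ℝ (Fin K ⊕ s) → EuclideanSpace ℝ (Fin K ⊕ s))
          (fun _ => P)
          (multivariateGaussian 0 (PairedComparison.asympCov s θ σ))) := by
  have hinj : ∀ δ : s → ℝ, PairedComparison.cycSubMatrix s *ᵥ δ = 0 → δ = 0 :=
    fun _ => PairedComparison.cycSubMatrix_mulVec_injective hγ hs
  have hν' : ν = PairedComparison.linMatrix K *ᵥ μ +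
      PairedComparison.cycSubMatrix s *ᵥ fun t : s => γ t.1 := by
    rw [← PairedComparison.cycMatrix_mulVec_extendTriads,
      PairedComparison.extendTriads_restrict hs, hγ.1, hν]
  refine ⟨fun n hn => ⟨fun y => PairedComparison.isLSE_iff y hinj hn, fun ε hε => ?_⟩,
    fun ε hε n hn => PairedComparison.tendstoInMeasure_estimator hinj hμ hν' hε hn,
    fun ε hε n hn θ hθ hnθ =>
      PairedComparison.tendstoInDistribution_estimator hinj hμ hν' hε hn hθ hnθ⟩
  have h := PairedComparison.integrable_and_integral_elim_response hinj hμ hν' hn hε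
  exact ⟨fun i => h (Sum.inl i), fun t => h (Sum.inr t)⟩
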